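/- **Conventions.** For finite $s,t\subseteq\mathbb N=\{1,2,\dots\}$ write $t\sqsubseteq s$ if $t$ is an initial segment of $s$, and let $s(k)$ denote the $k$-th smallest element of $s$ (likewise $M(l)$ for an infinite $M\subseteq\mathbb N$). For a family $\mathcal F$ of finite subsets of $\mathbb N$ let $\widehat{\mathcal F}=\{t:\exists s\in\mathcal F,\ t\sqsubseteq s\}$ and $\mathcal F\upharpoonright M=\{s\in\mathcal F: s\subseteq M\}$. The family $\mathcal F$ is *regular thin* if no member of $\mathcal F$ is a proper initial segment of another member, and $\widehat{\mathcal F}$ is hereditary (closed under subsets), compact (its characteristic functions form a closed subset of $\{0,1\}^{\mathbb N}$) and spreading (if $\{n_1<\dots<n_k\}\in\widehat{\mathcal F}$, $m_1<\dots<m_k$ and $n_i\le m_i$ for all $i$, then $\{m_1,\dots,m_k\}\in\widehat{\mathcal F}$). A tuple $(s_j)_{j=1}^k$ of nonempty finite sets is a *plegma family* if $s_i(p)<s_j(p)$ whenever $i<j$ and $p\le\min(|s_i|,|s_j|)$, and $s_i(p)<s_j(p+1)$ for all $i,j$ and all $p\le\min(|s_i|,|s_j|-1)$. Let $X$ be a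 real Banach space. An $\mathcal F$-sequence in $X$ is a family $(x_s)_{s\in\mathcal F}$ in $X$; it is *weakly relatively compact* if the weak closure of $\{x_s:s\in\mathcal F\}$ is weakly compact. For a linearly independent sequence $(e_n)_n$ in a real seminormed space $(E,\|\cdot\|_*)$ and an infinite $M\subseteq\mathbb N$, the subsequence $(x_s)_{s\in\mathcal F\upharpoonright M}$ *generates $(e_n)_n$ as an $\mathcal F$-spreading model* if there are $\delta_l>0$ with $\delta_l\to0$ such that $$\Big|\,\Big\|\sum_{j=1}^k a_jx_{s_j}\Big\|-\Big\|\sum_{j=1}^k a_je_j\Big\|_*\Big|\le\delta_l$$ for all $1\le k\le l$, all $a_1,\dots,a_k\in[-1,1]$ and all plegma families $(s_j)_{j=1}^k$ in $\mathcal F\upharpoonright M$ with $s_1(1)\ge M(l)$. The $\mathcal F$-sequence *admits* $(e_n)_n$ as an $\mathcal F$-spreading model if this holds for some infinite $M$. A sequence $(e_n)_n$ in a seminormed space is *spreading* if $\|\sum_{j=1}^n a_je_j\|_*=\|\sum_{j=1}^n a_je_{k_j}\|_*$ for all $n$, all real $a_j$ and all $k_1<\dots<k_n$. A spreading sequence is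 *trivial* if $\|e_n-e_m\|_*=0$ for all $n,m$. A sequence is *Schauder basic* if $\|e_n\|_*\neq0$ for all $n$ and there is $C\ge1$ with $\|\sum_{n\le k}a_ne_n\|_*\le C\|\sum_{n\le m}a_ne_n\|_*$ for all $k\le m$ and all real $a_n$; it is *unconditional* if there is $C$ with $\|\sum_{n\in A}a_ne_n\|_*\le C\|\sum_{n\le m}a_ne_n\|_*$ for all $m$, all $A\subseteq\{1,\dots,m\}$ and all real $a_n$. A spreading sequence is *singular* if it is neither trivial nor Schauder basic. The *natural decomposition* of a singular sequence is $e_n=e_n'+e$, where $e\ne0$ is the weak limit of $(e_n)_n$ in the Banach space generated by $(e_n)_n$ (the closed linear span of $(e_n)_n$ in the completion of $E$). **Corollary 6.15.** Let $X$ be a real Banach space, $\mathcal F$ a regular thin family having a nonempty member, and $(x_s)_{s\in\mathcal F}$ a weakly relatively compact $\mathcal F$-sequence in $X$. Let $(e_n)_n$ be a spreading sequence and assume that $(x_s)_{s\in\mathcal F}$ admits $(e_n)_n$ as an $\mathcal F$-spreading model. Then exactly one of the following holds. 1. The sequence $(e_n)_n$ is trivial. 2. The sequence $(e_n)_n$ is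 singular. In this case it has a natural decomposition $e_n=e_n'+e$, and there exist an infinite $L\subseteq\mathbb N$ and $x_0\in X$ such that $(x_s-x_0)_{s\in\mathcal F\upharpoonright L}$ generates $(e_n')_n$ as an $\mathcal F$-spreading model and $\|x_0\|=\|e\|$. 3. The sequence $(e_n)_n$ is Schauder basic. In this case $(e_n)_n$ is unconditional. -/

import Mathlib

open Filter Topology

namespace FSpread

/-! The positive integers are replaced by the order-isomorphic `ℕ`, so that all indices start
at `0`.  An infinite set of integers is given by its strictly increasing enumeration
`M : ℕ → ℕ`, so `M l` is its element number `l`. -/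

/-- `t` is an initial segment of `s`. -/
def IsInitSeg (t s : Finset ℕ) : Prop :=
  t ⊆ s ∧ ∀ b ∈ t, ∀ a ∈ s, a < b → a ∈ t

/-- The family of all initial segments of members of `F`. -/
def closureFam (F : Set (Finset ℕ)) : Set (Finset ℕ) :=
  {t | ∃ s ∈ F, IsInitSeg t s}

/-- No member of `F` is a proper initial segment of another one. -/
def IsThin (F : Set (Finset ℕ)) : Prop :=
  ∀ s ∈ F, ∀ t ∈ F, IsInitSeg s t → s = t

/-- All subsets of members are members. -/
def IsHereditary (R : Set (Finset ℕ)) : Prop :=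
  ∀ s ∈ R, ∀ t, t ⊆ s → t ∈ R

/-- If `{n₁ < ⋯ < n_k} ∈ R`, `m₁ < ⋯ < m_k` and `n_i ≤ m_i` for all `i`, then
`{m₁, …, m_k} ∈ R`. -/
def IsSpreadingFam (R : Set (Finset ℕ)) : Prop :=
  ∀ (k : ℕ) (n m : Fin k → ℕ), StrictMono n → StrictMono m → (∀ i, n i ≤ m i) →
    Finset.univ.image n ∈ R → Finset.univ.image m ∈ R

/-- The characteristic functions of the members form a closed set in the Cantor space. -/
def IsCompactFam (R : Set (Finset ℕ)) : Prop :=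
  IsClosed ((fun (s : Finset ℕ) (n : ℕ) => decide (n ∈ s)) '' R : Set (ℕ → Bool))

/-- Regular families: compact, hereditary and spreading. -/
structure IsRegularFam (R : Set (Finset ℕ)) : Prop where
  compact : IsCompactFam R
  hereditary : IsHereditary R
  spreading : IsSpreadingFam R

/-- Regular thin families. -/
structure IsRegularThin (F : Set (Finset ℕ)) : Prop where
  thin : IsThin F
  regular : IsRegularFam (closureFam F)

/-- The restriction of the family `F` to the infinite set enumerated by `M`. -/
def restrictFam (F : Set (Finset ℕ)) (M : ℕ → ℕ) : Set (Finset ℕ) :=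
  {s | s ∈ F ∧ (s : Set ℕ) ⊆ Set.range M}

/-- Element number `k` (counted from `0`, in increasing order) of `s`; used for `k < s.card`. -/
noncomputable def elt (s : Finset ℕ) (k : ℕ) : ℕ :=
  Nat.nth (fun n => n ∈ s) k

/-- Plegma families of length `l`. -/
structure IsPlegma {l : ℕ} (s : Fin l → Finset ℕ) : Prop where
  nonempty : ∀ i, (s i).Nonempty
  lt_same : ∀ i j, i < j → ∀ k, k < (s i).card → k < (s j).card → elt (s i) k < elt (s j) k
  lt_next : ∀ i j, ∀ k, k < (s i).card → k + 1 < (s j).card →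
    elt (s i) k < elt (s j) (k + 1)

section Sequences

variable {E : Type*} [SeminormedAddCommGroup E] [NormedSpace ℝ E]

/-- Spreading sequences in a seminormed space. -/
def IsSpreadingSeq (e : ℕ → E) : Prop :=
  ∀ (n : ℕ) (a : Fin n → ℝ) (k : Fin n → ℕ), StrictMono k →
    ‖∑ j, a j • e (j : ℕ)‖ = ‖∑ j, a j • e (k j)‖

/-- Trivial (spreading) sequences. -/
def IsTrivialSeq (e : ℕ → E) : Prop :=
  ∀ n m, ‖e n - e m‖ = 0

/-- Schauder basic sequences; as usual, the terms are required to be nonzero. -/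
def IsSchauderBasic (e : ℕ → E) : Prop :=
  (∀ n, ‖e n‖ ≠ 0) ∧
  ∃ C : ℝ, 1 ≤ C ∧ ∀ (k m : ℕ), k ≤ m → ∀ a : ℕ → ℝ,
    ‖∑ n ∈ Finset.range k, a n • e n‖ ≤ C * ‖∑ n ∈ Finset.range m, a n • e n‖

/-- Unconditional sequences. -/
def IsUnconditional (e : ℕ → E) : Prop :=
  ∃ C : ℝ, ∀ (m : ℕ) (A : Finset ℕ), A ⊆ Finset.range m → ∀ a : ℕ → ℝ,
    ‖∑ n ∈ A, a n • e n‖ ≤ C * ‖∑ n ∈ Finset.range m, a n • e n‖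

/-- Singular sequences: nontrivial spreading sequences that are not Schauder basic. -/
def IsSingular (e : ℕ → E) : Prop :=
  IsSpreadingSeq e ∧ ¬ IsTrivialSeq e ∧ ¬ IsSchauderBasic e

/-- `v` is the nonzero weak limit of `(e n)` in the Banach space generated by `(e n)`, which is
realized as a closed subspace of the completion of `E`.  The natural decomposition of a singular
sequence is then `e n = (e n - v) + v`. -/
def IsNaturalPart (e : ℕ → E) (v : UniformSpace.Completion E) : Prop :=
  v ≠ 0 ∧
  v ∈ (Submodule.span ℝ
    (Set.range fun n => (e n : UniformSpace.Completion E))).topologicalClosure ∧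
  Tendsto (fun n => toWeakSpace ℝ (UniformSpace.Completion E) (e n : UniformSpace.Completion E))
    atTop (𝓝 (toWeakSpace ℝ (UniformSpace.Completion E) v))

variable {X : Type*} [NormedAddCommGroup X] [NormedSpace ℝ X]

/-- The subsequence of `(x s)`, `s ∈ F`, on the infinite set enumerated by `M` generates `e` as an
`F`-spreading model.  The sequence `e` is a Hamel basis of its linear span.  With indices counted
from `0`, tuples of length at most `l + 1` are controlled as soon as their least element is
at least `M l`. -/
def Generates (F : Set (Finset ℕ)) (x : Finset ℕ → X) (M : ℕ → ℕ) (e : ℕ → E) : Prop :=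
  LinearIndependent ℝ e ∧
  ∃ δ : ℕ → ℝ, (∀ l, 0 < δ l) ∧ Tendsto δ atTop (𝓝 0) ∧
    ∀ (l k : ℕ), k ≤ l → ∀ a : Fin (k + 1) → ℝ, (∀ j, a j ∈ Set.Icc (-1 : ℝ) 1) →
      ∀ s : Fin (k + 1) → Finset ℕ, (∀ j, s j ∈ restrictFam F M) → IsPlegma s →
        M l ≤ elt (s 0) 0 →
          |‖∑ j, a j • x (s j)‖ - ‖∑ j, a j • e (j : ℕ)‖| ≤ δ l

/-- `(x s)`, `s ∈ F`, admits `e` as an `F`-spreading model. -/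
def Admits (F : Set (Finset ℕ)) (x : Finset ℕ → X) (e : ℕ → E) : Prop :=
  ∃ M : ℕ → ℕ, StrictMono M ∧ Generates F x M e

/-- The `F`-sequence `(x s)`, `s ∈ F`, is weakly relatively compact.  Only the values of `x` on
`F` matter. -/
def IsWRC (F : Set (Finset ℕ)) (x : Finset ℕ → X) : Prop :=
  IsCompact (closure (toWeakSpace ℝ X '' (x '' F)))

end Sequences

end FSpread

namespace FSpread

theorem elt_mem {s : Finset ℕ} {k : ℕ} (hk : k < s.card) : elt s k ∈ s := by
  refine Nat.nth_mem (p := fun n => n ∈ s) k fun hf => ?_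
  simpa using hk

theorem elt_lt_elt {s : Finset ℕ} {i j : ℕ} (hij : i < j) (hj : j < s.card) :
    elt s i < elt s j := by
  refine Nat.nth_lt_nth' (p := fun n => n ∈ s) hij fun hf => ?_
  simpa using hj

theorem exists_elt_eq {s : Finset ℕ} {a : ℕ} (ha : a ∈ s) : ∃ k < s.card, elt s k = a := by
  classical
  obtain ⟨n, hn, h⟩ := Nat.exists_lt_card_nth_eq (p := fun n => n ∈ s) ha
  refine ⟨n, (hn s.finite_toSet).trans_eq ?_, h⟩
  congr 1
  ext b
  simp

theorem elt_insert_of_lt {t : Finset ℕ} {m i : ℕ} (hm : ∀ a ∈ t, a < m) (hi : i < t.card) :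
    elt (insert m t) i = elt t i := by
  classical
  have ha := elt_mem hi
  have h1 : Nat.count (fun n => n ∈ insert m t) (elt t i) = i := by
    have hc : Nat.count (fun n => n ∈ t) (elt t i) = i :=
      Nat.count_nth (p := fun n => n ∈ t) (n := i) (fun hf => by simpa using hi)
    refine Eq.trans ?_ hc
    rw [Nat.count_eq_card_filter_range, Nat.count_eq_card_filter_range]
    congr 1
    ext b
    simp only [Finset.mem_filter, Finset.mem_range, Finset.mem_insert]
    have := hm _ ha
    constructor
    · rintro ⟨h, rfl | h'⟩
      · omega
      · exact ⟨h, h'⟩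
    · rintro ⟨h, h'⟩
      exact ⟨h, Or.inr h'⟩
  have h2 := Nat.nth_count (p := fun n => n ∈ insert m t) (n := elt t i)
    (Finset.mem_insert_of_mem ha)
  rw [h1] at h2
  exact h2

theorem elt_insert_card {t : Finset ℕ} {m : ℕ} (hm : ∀ a ∈ t, a < m) :
    elt (insert m t) t.card = m := by
  classical
  have h1 : Nat.count (fun n => n ∈ insert m t) m = t.card := by
    rw [Nat.count_eq_card_filter_range]
    congr 1
    ext b
    simp only [Finset.mem_filter, Finset.mem_range, Finset.mem_insert]
    constructor
    · rintro ⟨h, rfl | h'⟩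
      · omega
      · exact h'
    · exact fun h => ⟨hm b h, Or.inr h⟩
  have h2 := Nat.nth_count (p := fun n => n ∈ insert m t) (n := m)
    (Finset.mem_insert_self m t)
  rw [h1] at h2
  exact h2

theorem empty_mem_closureFam {F : Set (Finset ℕ)} (h : F.Nonempty) : ∅ ∈ closureFam F := by
  obtain ⟨s, hs⟩ := h
  exact ⟨s, hs, by simp, by simp⟩

theorem empty_notMem_of_isThin {F : Set (Finset ℕ)} (hF : IsThin F)
    (h : ∃ s ∈ F, s.Nonempty) : ∅ ∉ F := by
  rintro h0
  obtain ⟨s, hs, hne⟩ := h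
  have := hF ∅ h0 s hs ⟨by simp, by simp⟩
  subst this
  simp at hne

/-- A node of the tree `closureFam F` which is not in `F` has all large one-point extensions. -/
theorem eventually_insert_mem_closureFam {F : Set (Finset ℕ)} (hF : IsSpreadingFam (closureFam F))
    {t : Finset ℕ} (ht : t ∈ closureFam F) (htF : t ∉ F) :
    ∀ᶠ m in atTop, insert m t ∈ closureFam F := by
  classical
  obtain ⟨s, hs, hts, hseg⟩ := ht
  have hne : (s \ t).Nonempty := by
    rw [Finset.sdiff_nonempty]
    intro h
    exact htF (Finset.Subset.antisymm hts h ▸ hs)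
  set a := (s \ t).min' hne with ha
  have has : a ∈ s \ t := Finset.min'_mem _ _
  rw [Finset.mem_sdiff] at has
  have hlt : ∀ b ∈ t, b < a := by
    intro b hb
    by_contra h
    rcases (not_lt.1 h).eq_or_lt with h | h
    · exact has.2 (h ▸ hb)
    · exact has.2 (hseg b hb a has.1 h)
  have hin : insert a t ∈ closureFam F := by
    refine ⟨s, hs, Finset.insert_subset has.1 hts, ?_⟩
    intro b hb c hc hcb
    by_cases hct : c ∈ t
    · exact Finset.mem_insert_of_mem hct
    have : a ≤ c := Finset.min'_le _ _ (Finset.mem_sdiff.2 ⟨hc, hct⟩)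
    rcases Finset.mem_insert.1 hb with rfl | hb
    · omega
    · have := hlt b hb
      omega
  filter_upwards [eventually_ge_atTop a] with m hm
  have key := hF (insert a t).card ((insert a t).orderEmbOfFin rfl)
    (fun i => if (insert a t).orderEmbOfFin rfl i = a then m else (insert a t).orderEmbOfFin rfl i)
    (OrderEmbedding.strictMono _) ?_ ?_ ?_
  · convert key
    ext b
    simp only [Finset.mem_insert, Finset.mem_image, Finset.mem_univ, true_and]
    have hr : ∀ c, (∃ i, (insert a t).orderEmbOfFin rfl i = c) ↔ c ∈ insert a t := by
      intro c
      have := Finset.range_orderEmbOfFin (insert a t) rfl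
      rw [← Finset.mem_coe, ← this]; rfl
    constructor
    · rintro (rfl | hb)
      · obtain ⟨i, hi⟩ := (hr a).2 (Finset.mem_insert_self a t)
        exact ⟨i, by simp [hi]⟩
      · obtain ⟨i, hi⟩ := (hr b).2 (Finset.mem_insert_of_mem hb)
        refine ⟨i, ?_⟩
        rw [if_neg, hi]
        rw [hi]
        have := hlt b hb
        omega
    · rintro ⟨i, hi⟩
      split_ifs at hi with h
      · exact Or.inl hi.symm
      · have := (hr b).1 ⟨i, hi⟩
        rcases Finset.mem_insert.1 this with rfl | h'
        · exact absurd hi h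
        · exact Or.inr h'
  · intro i j hij
    have h1 : (insert a t).orderEmbOfFin rfl i < (insert a t).orderEmbOfFin rfl j :=
      (OrderEmbedding.strictMono _) hij
    have h2 : (insert a t).orderEmbOfFin rfl j ≤ a := by
      have := Finset.orderEmbOfFin_mem (insert a t) rfl j
      rcases Finset.mem_insert.1 this with h | h
      · exact h.le
      · exact (hlt _ h).le
    dsimp only
    split_ifs <;> omega
  · intro i
    split_ifs <;> omega
  · convert hin
    ext b
    have := Finset.range_orderEmbOfFin (insert a t) rfl
    rw [← Finset.mem_coe, ← Finset.mem_coe (s := insert a t), ← this]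
    simp

/-- `t'` is a one-point end-extension of `t` in the tree `R`. -/
def IsExtension (R : Set (Finset ℕ)) (t' t : Finset ℕ) : Prop :=
  t ∈ R ∧ t' ∈ R ∧ ∃ m, (∀ a ∈ t, a < m) ∧ t' = insert m t

theorem wellFounded_isExtension {R : Set (Finset ℕ)} (hR : IsCompactFam R) :
    WellFounded (IsExtension R) := by
  classical
  rw [wellFounded_iff_isEmpty_descending_chain]
  refine ⟨fun ⟨f, hf⟩ => ?_⟩
  have hmono : Monotone f := by
    refine monotone_nat_of_le_succ fun n => ?_
    obtain ⟨-, -, m, -, h⟩ := hf n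
    rw [h]
    exact Finset.subset_insert _ _
  have hcard : ∀ n, n ≤ (f n).card := by
    intro n
    induction n with
    | zero => simp
    | succ n ih =>
      obtain ⟨-, -, m, hm, h⟩ := hf n
      rw [h, Finset.card_insert_of_notMem (fun h => lt_irrefl _ (hm _ h))]
      omega
  have hlim : Tendsto (fun n => (fun b => decide (b ∈ f n) : ℕ → Bool)) atTop
      (𝓝 fun b => decide (∃ n, b ∈ f n)) := by
    rw [tendsto_pi_nhds]
    intro b
    refine tendsto_const_nhds.congr' ?_
    by_cases h : ∃ n, b ∈ f n
    · obtain ⟨n, hn⟩ := h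
      filter_upwards [eventually_ge_atTop n] with k hk
      have : b ∈ f k := hmono hk hn
      simp only [this, decide_true, decide_eq_true_eq]
      exact ⟨n, hn⟩
    · filter_upwards with k
      have : b ∉ f k := fun h' => h ⟨k, h'⟩
      simp [h, this]
  have hmem := hR.mem_of_tendsto hlim (Eventually.of_forall fun n => ⟨f n, (hf n).1, rfl⟩)
  obtain ⟨s, -, hs⟩ := hmem
  have hsub : f (s.card + 1) ⊆ s := by
    intro b hb
    have := congrFun hs b
    simp only [decide_eq_decide] at this
    exact this.2 ⟨_, hb⟩
  have := Finset.card_le_card hsub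
  have := hcard (s.card + 1)
  omega

section Tree

variable {X : Type*} [NormedAddCommGroup X] [NormedSpace ℝ X]

/-- A weakly relatively compact `F`-sequence extends to the tree `closureFam F` in such a way that
the value at an inner node is a weak limit of the values at its successors. -/
theorem exists_weak_limit_extension {F : Set (Finset ℕ)} (hF : IsRegularThin F) {x : Finset ℕ → X}
    (hx : IsWRC F x) {M : ℕ → ℕ} (hM : StrictMono M) :
    ∃ φ : Finset ℕ → X, (∀ s ∈ F, φ s = x s) ∧ ∀ t ∈ closureFam F, t ∉ F →
      Tendsto (fun j => toWeakSpace ℝ X (φ (insert (M j) t))) (hyperfilter ℕ)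
        (𝓝 (toWeakSpace ℝ X (φ t))) := by
  classical
  have hwf := wellFounded_isExtension hF.regular.compact
  let G : (t : Finset ℕ) → ((t' : Finset ℕ) → IsExtension (closureFam F) t' t → X) → X :=
    fun t ih => if t ∈ F then x t else Classical.epsilon fun v : X =>
      Tendsto (fun j => if h : IsExtension (closureFam F) (insert (M j) t) t
        then toWeakSpace ℝ X (ih _ h) else 0) (hyperfilter ℕ) (𝓝 (toWeakSpace ℝ X v))
  let φ : Finset ℕ → X := hwf.fix G
  have hφ : ∀ t, φ t = G t fun t' _ => φ t' := fun t => hwf.fix_eq G t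
  have hleaf : ∀ s ∈ F, φ s = x s := by
    intro s hs
    rw [hφ]
    simp [G, hs]
  have hev : ∀ t ∈ closureFam F, t ∉ F →
      ∀ᶠ j in (hyperfilter ℕ : Filter ℕ), IsExtension (closureFam F) (insert (M j) t) t := by
    intro t ht htF
    have h1 := hM.tendsto_atTop.eventually
      (eventually_insert_mem_closureFam hF.regular.spreading ht htF)
    have h2 := hM.tendsto_atTop.eventually (eventually_gt_atTop (t.sup id))
    have h3 : ∀ᶠ j in atTop, IsExtension (closureFam F) (insert (M j) t) t := by
      filter_upwards [h1, h2] with j h1 h2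
      exact ⟨ht, h1, M j, fun a ha => (Finset.le_sup (f := id) ha).trans_lt h2, rfl⟩
    rw [← Nat.cofinite_eq_atTop] at h3
    exact hyperfilter_le_cofinite h3
  have hmain : ∀ t, t ∈ closureFam F →
      toWeakSpace ℝ X (φ t) ∈ closure (toWeakSpace ℝ X '' (x '' F)) ∧ (t ∉ F →
        Tendsto (fun j => toWeakSpace ℝ X (φ (insert (M j) t))) (hyperfilter ℕ)
          (𝓝 (toWeakSpace ℝ X (φ t)))) := by
    intro t
    induction t using hwf.induction with
    | _ t ih =>
    intro ht
    by_cases htF : t ∈ F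
    · refine ⟨subset_closure ⟨_, ⟨t, htF, rfl⟩, by rw [hleaf t htF]⟩, fun h => absurd htF h⟩
    · have hK : ∀ᶠ j in (hyperfilter ℕ : Filter ℕ),
          toWeakSpace ℝ X (φ (insert (M j) t)) ∈ closure (toWeakSpace ℝ X '' (x '' F)) := by
        filter_upwards [hev t ht htF] with j hj
        exact (ih _ hj hj.2.1).1
      have hlim : ∃ v : X, Tendsto (fun j => toWeakSpace ℝ X (φ (insert (M j) t)))
          (hyperfilter ℕ) (𝓝 (toWeakSpace ℝ X v)) := by
        obtain ⟨w, -, hw⟩ := IsCompact.ultrafilter_le_nhds hx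
          ((hyperfilter ℕ).map fun j => toWeakSpace ℝ X (φ (insert (M j) t)))
          (by rw [le_principal_iff]; exact hK)
        exact ⟨(toWeakSpace ℝ X).symm w, by
          rw [LinearEquiv.apply_symm_apply]; exact hw⟩
      have heq : ∀ v : X, Tendsto (fun j => if h : IsExtension (closureFam F) (insert (M j) t) t
          then toWeakSpace ℝ X (φ (insert (M j) t)) else 0) (hyperfilter ℕ)
            (𝓝 (toWeakSpace ℝ X v)) ↔
          Tendsto (fun j => toWeakSpace ℝ X (φ (insert (M j) t))) (hyperfilter ℕ)
            (𝓝 (toWeakSpace ℝ X v)) := by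
        intro v
        refine tendsto_congr' ?_
        filter_upwards [hev t ht htF] with j hj
        rw [dif_pos hj]
      have hφt : Tendsto (fun j => toWeakSpace ℝ X (φ (insert (M j) t))) (hyperfilter ℕ)
          (𝓝 (toWeakSpace ℝ X (φ t))) := by
        rw [hφ t]
        simp only [G, if_neg htF, heq]
        exact Classical.epsilon_spec hlim
      exact ⟨isClosed_closure.mem_of_tendsto hφt hK, fun _ => hφt⟩
  exact ⟨φ, hleaf, fun t ht => (hmain t ht).2⟩

/-- Mazur's theorem along the tree: an inner node value is approximated in norm by convex
combinations of the values at finitely many far successors. -/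
theorem eventually_exists_convexHull_near {F : Set (Finset ℕ)} (hF : IsRegularThin F) {M : ℕ → ℕ}
    (hM : StrictMono M) {φ : Finset ℕ → X} {t : Finset ℕ} (ht : t ∈ closureFam F) (htF : t ∉ F)
    (hφ : Tendsto (fun j => toWeakSpace ℝ X (φ (insert (M j) t))) (hyperfilter ℕ)
        (𝓝 (toWeakSpace ℝ X (φ t)))) (a : ℕ) {ε : ℝ} (hε : 0 < ε) :
    ∀ᶠ b in atTop, ∃ y ∈ convexHull ℝ
      (φ '' {t' ∈ closureFam F | ∃ j, a ≤ j ∧ j < b ∧ t' = insert (M j) t}), ‖y - φ t‖ ≤ ε := by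
  classical
  set S : Set X := φ '' {t' ∈ closureFam F | ∃ j, a ≤ j ∧ t' = insert (M j) t} with hS
  have hmem : ∀ᶠ j in (hyperfilter ℕ : Filter ℕ),
      toWeakSpace ℝ X (φ (insert (M j) t)) ∈ toWeakSpace ℝ X '' (convexHull ℝ S) := by
    have h1 := hM.tendsto_atTop.eventually
      (eventually_insert_mem_closureFam hF.regular.spreading ht htF)
    have h3 : ∀ᶠ j in atTop,
        toWeakSpace ℝ X (φ (insert (M j) t)) ∈ toWeakSpace ℝ X '' (convexHull ℝ S) := by
      filter_upwards [h1, eventually_ge_atTop a] with j h1 h2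
      exact ⟨_, subset_convexHull ℝ _ ⟨_, ⟨h1, j, h2, rfl⟩, rfl⟩, rfl⟩
    rw [← Nat.cofinite_eq_atTop] at h3
    exact hyperfilter_le_cofinite h3
  have hcl : φ t ∈ closure (convexHull ℝ S) := by
    have := mem_closure_of_tendsto hφ hmem
    rw [← (convex_convexHull ℝ S).toWeakSpace_closure ℝ] at this
    obtain ⟨z, hz, hzt⟩ := this
    rwa [(toWeakSpace ℝ X).injective hzt] at hz
  obtain ⟨y, hy, hyt⟩ := Metric.mem_closure_iff.1 hcl ε hε
  rw [convexHull_eq_union_convexHull_finite_subsets] at hy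
  simp only [Set.mem_iUnion] at hy
  obtain ⟨T, hTS, hyT⟩ := hy
  have hb : ∀ᶠ b in atTop, ∀ z ∈ T,
      z ∈ φ '' {t' ∈ closureFam F | ∃ j, a ≤ j ∧ j < b ∧ t' = insert (M j) t} := by
    rw [Filter.eventually_all_finset]
    intro z hz
    obtain ⟨t', ⟨h1, j, h2, h3⟩, h4⟩ := hTS hz
    filter_upwards [eventually_gt_atTop j] with b hb
    exact ⟨t', ⟨h1, j, h2, hb, h3⟩, h4⟩
  filter_upwards [hb] with b hb
  refine ⟨y, convexHull_mono (fun z hz => hb z hz) hyT, ?_⟩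
  rw [dist_eq_norm, norm_sub_rev] at hyt
  exact hyt.le

/-- The members of `F ↾ M` whose element number `p` lies in the interval number `q p` of the
partition of `ℕ` defined by the points `M (h i)`. -/
def slotFam (F : Set (Finset ℕ)) (M h q : ℕ → ℕ) : Set (Finset ℕ) :=
  {t ∈ restrictFam F M | ∀ p < t.card, M (h (q p)) ≤ elt t p ∧ elt t p < M (h (q p + 1))}

open scoped Pointwise in
theorem exists_slots_convexHull_near {F : Set (Finset ℕ)} (hF : IsRegularThin F)
    (hF₁ : ∃ s ∈ F, s.Nonempty) {x : Finset ℕ → X}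
    (hx : IsWRC F x) {M : ℕ → ℕ} (hM : StrictMono M) :
    ∃ (x₀ : X) (h : ℕ → ℕ), StrictMono h ∧ ∀ q : ℕ → ℕ, StrictMono q →
      ∃ y ∈ convexHull ℝ (x '' slotFam F M h q), ‖y - x₀‖ ≤ 2 * (1 / 2) ^ q 0 := by
  classical
  obtain ⟨φ, hleaf, hφ⟩ := exists_weak_limit_extension hF hx hM
  have hstep : ∀ a, ∃ b, a < b ∧ ∀ t ∈ (Finset.image M (Finset.range a)).powerset,
      t ∈ closureFam F → t ∉ F → ∃ y ∈ convexHull ℝ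
        (φ '' {t' ∈ closureFam F | ∃ j, a ≤ j ∧ j < b ∧ t' = insert (M j) t}),
          ‖y - φ t‖ ≤ (1 / 2) ^ a := by
    intro a
    have : ∀ᶠ b in atTop, ∀ t ∈ (Finset.image M (Finset.range a)).powerset,
      t ∈ closureFam F → t ∉ F → ∃ y ∈ convexHull ℝ
        (φ '' {t' ∈ closureFam F | ∃ j, a ≤ j ∧ j < b ∧ t' = insert (M j) t}),
          ‖y - φ t‖ ≤ (1 / 2) ^ a := by
      rw [Filter.eventually_all_finset]
      intro t _
      by_cases h1 : t ∈ closureFam F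
      · by_cases h2 : t ∈ F
        · simp [h2]
        · filter_upwards [eventually_exists_convexHull_near hF hM h1 h2 (hφ t h1 h2) a
            (ε := (1 / 2) ^ a) (by positivity)] with b hb
          exact fun _ _ => hb
      · simp [h1]
    exact ((eventually_gt_atTop a).and this).exists
  choose g hg1 hg2 using hstep
  let h : ℕ → ℕ := fun n => g^[n] 0
  have hsucc : ∀ n, h (n + 1) = g (h n) := fun n => Function.iterate_succ_apply' g n 0
  have hmono : StrictMono h := strictMono_nat_of_lt_succ fun n => by rw [hsucc]; exact hg1 _
  refine ⟨φ ∅, h, hmono, fun q hq => ?_⟩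
  set C := convexHull ℝ (x '' slotFam F M h q) with hC
  have hMh : StrictMono fun n => M (h n) := hM.comp hmono
  have key : ∀ τ, τ ∈ closureFam F → (τ : Set ℕ) ⊆ Set.range M →
      (∀ p < τ.card, M (h (q p)) ≤ elt τ p ∧ elt τ p < M (h (q p + 1))) →
      ∃ y ∈ C, ‖y - φ τ‖ ≤ 2 * (1 / 2) ^ q τ.card := by
    intro τ
    induction τ using (wellFounded_isExtension hF.regular.compact).induction with
    | _ τ ih =>
    intro hτ hτM hτq
    by_cases hτF : τ ∈ F
    · refine ⟨x τ, subset_convexHull ℝ _ ⟨τ, ⟨⟨hτF, hτM⟩, hτq⟩, rfl⟩, ?_⟩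
      rw [hleaf τ hτF, sub_self, norm_zero]
      positivity
    have hlt : ∀ b ∈ τ, b < M (h (q τ.card)) := by
      intro b hb
      obtain ⟨i, hi, rfl⟩ := exists_elt_eq hb
      exact (hτq i hi).2.trans_le (hMh.monotone (Nat.succ_le_of_lt (hq hi)))
    have hsub : τ ∈ (Finset.image M (Finset.range (h (q τ.card)))).powerset := by
      rw [Finset.mem_powerset]
      intro b hb
      obtain ⟨j, rfl⟩ := hτM hb
      exact Finset.mem_image_of_mem _ (Finset.mem_range.2 (hM.lt_iff_lt.1 (hlt _ hb)))
    obtain ⟨z, hz, hzτ⟩ := hg2 _ τ hsub hτ hτF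
    have hzC : z ∈ C + Metric.closedBall (0 : X) ((1 / 2) ^ q τ.card) := by
      refine convexHull_min ?_ ((convex_convexHull ℝ _).add (convex_closedBall _ _)) hz
      rintro _ ⟨t', ⟨ht', j, hj1, hj2, rfl⟩, rfl⟩
      have hlt' : ∀ a ∈ τ, a < M j := fun a ha => (hlt a ha).trans_le (hM.monotone hj1)
      have hcard : (insert (M j) τ).card = τ.card + 1 :=
        Finset.card_insert_of_notMem fun h => lt_irrefl _ (hlt' _ h)
      have hsubset : ((insert (M j) τ : Finset ℕ) : Set ℕ) ⊆ Set.range M := by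
        rw [Finset.coe_insert, Set.insert_subset_iff]
        exact ⟨⟨j, rfl⟩, hτM⟩
      have hslots : ∀ p < (insert (M j) τ).card, M (h (q p)) ≤ elt (insert (M j) τ) p ∧
          elt (insert (M j) τ) p < M (h (q p + 1)) := by
        intro p hp
        rw [hcard] at hp
        rcases (Nat.lt_succ_iff.1 hp).lt_or_eq with hp | rfl
        · rw [elt_insert_of_lt hlt' hp]
          exact hτq p hp
        · rw [elt_insert_card hlt', hsucc]
          exact ⟨hM.monotone hj1, hM hj2⟩
      obtain ⟨y, hy, hyn⟩ := ih (insert (M j) τ) ⟨hτ, ht', M j, hlt', rfl⟩ ht' hsubset hslots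
      refine ⟨y, hy, φ (insert (M j) τ) - y, ?_, by simp⟩
      rw [mem_closedBall_zero_iff, norm_sub_rev]
      refine hyn.trans ?_
      have : q τ.card + 1 ≤ q (insert (M j) τ).card := by
        rw [hcard]; exact hq (Nat.lt_succ_self _)
      calc (2 : ℝ) * (1 / 2) ^ q (insert (M j) τ).card
          ≤ 2 * (1 / 2) ^ (q τ.card + 1) := by
            refine mul_le_mul_of_nonneg_left ?_ two_pos.le
            exact pow_le_pow_of_le_one (by norm_num) (by norm_num) this
        _ = (1 / 2) ^ q τ.card := by ring
    obtain ⟨y, hy, w, hw, rfl⟩ := hzC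
    refine ⟨y, hy, ?_⟩
    rw [mem_closedBall_zero_iff] at hw
    have h1 : ((1 : ℝ) / 2) ^ h (q τ.card) ≤ (1 / 2) ^ q τ.card :=
      pow_le_pow_of_le_one (by norm_num) (by norm_num) (hmono.le_apply)
    have h2 : y - φ τ = (y + w - φ τ) - w := by abel
    rw [h2]
    calc ‖(y + w - φ τ) - w‖ ≤ ‖y + w - φ τ‖ + ‖w‖ := norm_sub_le _ _
      _ ≤ 2 * (1 / 2) ^ q τ.card := by
        have : ‖y + w - φ τ‖ ≤ (1 / 2) ^ h (q τ.card) := hzτ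
        linarith
  have h0 := key ∅ (empty_mem_closureFam ⟨_, hF₁.choose_spec.1⟩) (by simp) (by simp)
  simpa using h0

end Tree

/-- Levels separating the consecutive element positions of a plegma family in `F ↾ L`. -/
theorem IsPlegma.exists_levels {F : Set (Finset ℕ)} {L : ℕ → ℕ} (hL : StrictMono L) {k : ℕ}
    {s : Fin k → Finset ℕ} (hs : IsPlegma s) (hsL : ∀ j, s j ∈ restrictFam F L) {l : ℕ}
    (hl : ∀ j, L l ≤ elt (s j) 0) :
    ∃ c : ℕ → ℕ, StrictMono c ∧ l ≤ c 0 ∧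
      (∀ j p, p < (s j).card → elt (s j) p ≤ L (c p)) ∧
      ∀ j p, p + 1 < (s j).card → L (c p + 1) ≤ elt (s j) (p + 1) := by
  have hidx : ∀ j p, ∃ i, p < (s j).card → L i = elt (s j) p := by
    intro j p
    by_cases hp : p < (s j).card
    · obtain ⟨i, hi⟩ := (hsL j).2 (elt_mem hp)
      exact ⟨i, fun _ => hi⟩
    · exact ⟨0, fun h => absurd h hp⟩
  choose idx hidx using hidx
  let B : ℕ → ℕ := fun p => Finset.univ.sup fun j => if p < (s j).card then idx j p else 0
  let c : ℕ → ℕ := fun p => Nat.rec (max l (B 0)) (fun p c => max (c + 1) (B (p + 1))) p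
  have hc0 : c 0 = max l (B 0) := rfl
  have hc1 : ∀ p, c (p + 1) = max (c p + 1) (B (p + 1)) := fun p => rfl
  have hBc : ∀ p, B p ≤ c p := by
    intro p
    cases p with
    | zero => exact le_max_right _ _
    | succ p => exact le_max_right _ _
  have hBlt : ∀ j p, p + 1 < (s j).card → B p < idx j (p + 1) := by
    intro j p hp
    have hpos : 0 < idx j (p + 1) := by
      have h1 : elt (s j) p < elt (s j) (p + 1) := elt_lt_elt (Nat.lt_succ_self p) hp
      rw [← hidx j p (by omega), ← hidx j _ hp, hL.lt_iff_lt] at h1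
      omega
    refine (Finset.sup_lt_iff hpos).2 fun i _ => ?_
    split_ifs with hi
    · have := hs.lt_next i j p hi hp
      rwa [← hidx i p hi, ← hidx j _ hp, hL.lt_iff_lt] at this
    · exact hpos
  have hclt : ∀ p j, p + 1 < (s j).card → c p < idx j (p + 1) := by
    intro p
    induction p with
    | zero =>
      intro j hp
      rw [hc0, max_lt_iff]
      refine ⟨?_, hBlt j 0 hp⟩
      have h1 := (hl j).trans_lt (elt_lt_elt (Nat.lt_succ_self 0) hp)
      rwa [← hidx j _ hp, hL.lt_iff_lt] at h1
    | succ p ih =>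
      intro j hp
      rw [hc1, max_lt_iff]
      refine ⟨?_, hBlt j _ hp⟩
      have h1 := ih j (by omega)
      have h2 : elt (s j) (p + 1) < elt (s j) (p + 1 + 1) := elt_lt_elt (Nat.lt_succ_self _) hp
      rw [← hidx j _ hp, ← hidx j (p + 1) (by omega), hL.lt_iff_lt] at h2
      omega
  refine ⟨c, strictMono_nat_of_lt_succ fun p => ?_, le_max_left _ _, fun j p hp => ?_,
    fun j p hp => ?_⟩
  · exact (Nat.lt_succ_self _).trans_le (le_max_left _ _)
  · rw [← hidx j p hp]
    refine hL.monotone (le_trans ?_ (hBc p))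
    have := Finset.le_sup (f := fun j => if p < (s j).card then idx j p else 0)
      (Finset.mem_univ j)
    simpa [hp] using this
  · rw [← hidx j _ hp]
    exact hL.monotone (hclt p j hp)

theorem IsPlegma.append {k n : ℕ} {s : Fin k → Finset ℕ} (hs : IsPlegma s)
    {t : Fin n → Finset ℕ} (htne : ∀ i, (t i).Nonempty) {lo hi : ℕ → ℕ}
    (hlohi : ∀ p, hi p ≤ lo (p + 1))
    (hs1 : ∀ j p, p < (s j).card → elt (s j) p ≤ lo p)
    (hs2 : ∀ j p, p + 1 < (s j).card → hi p ≤ elt (s j) (p + 1))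
    (ht1 : ∀ i p, p < (t i).card → lo p < elt (t i) p ∧ elt (t i) p < hi p)
    (ht2 : ∀ i j, i < j → ∀ p, p < (t i).card → p < (t j).card → elt (t i) p < elt (t j) p) :
    IsPlegma (Fin.append s t) := by
  constructor
  · intro i
    refine Fin.addCases (fun i => ?_) (fun i => ?_) i
    · simpa using hs.nonempty i
    · simpa using htne i
  · intro i j
    refine Fin.addCases (fun i => ?_) (fun i => ?_) i <;>
    refine Fin.addCases (fun j => ?_) (fun j => ?_) j <;>
    simp only [Fin.append_left, Fin.append_right] <;> intro hij p hi' hj'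
    · exact hs.lt_same i j hij p hi' hj'
    · exact (hs1 i p hi').trans_lt (ht1 j p hj').1
    · exfalso
      have := j.isLt
      simp only [Fin.lt_def, Fin.val_natAdd, Fin.val_castAdd] at hij
      omega
    · exact ht2 i j (by simpa using hij) p hi' hj'
  · intro i j
    refine Fin.addCases (fun i => ?_) (fun i => ?_) i <;>
    refine Fin.addCases (fun j => ?_) (fun j => ?_) j <;>
    simp only [Fin.append_left, Fin.append_right] <;> intro p hi' hj'
    · exact hs.lt_next i j p hi' hj'
    · have h1 := hs1 i p hi'
      have h2 := (ht1 j _ hj').1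
      by_cases h : p < (t j).card
      · have := (ht1 j p h)
        have := hlohi p
        omega
      · omega
    · exact (ht1 i p hi').2.trans_le (hs2 j p hj')
    · have := (ht1 i p hi').2
      have := (ht1 j _ hj').1
      have := hlohi p
      omega

section Extend

variable {X : Type*} [NormedAddCommGroup X] [NormedSpace ℝ X]

/-- For a sufficiently sparse `L`, plegma families in `F ↾ L` can be extended by members of `F ↾ M`
taken from families whose values have `x₀` almost in their convex hull. -/
theorem exists_plegma_extension {F : Set (Finset ℕ)} (hF : IsRegularThin F)
    (hF₁ : ∃ s ∈ F, s.Nonempty) {x : Finset ℕ → X}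
    (hx : IsWRC F x) {M : ℕ → ℕ} (hM : StrictMono M) :
    ∃ (x₀ : X) (L : ℕ → ℕ), StrictMono L ∧ Set.range L ⊆ Set.range M ∧ (∀ l, M l ≤ L l) ∧
      ∀ (l n k : ℕ) (s : Fin k → Finset ℕ), n ≤ l → (∀ j, s j ∈ restrictFam F L) → IsPlegma s →
        (∀ j, L l ≤ elt (s j) 0) →
        ∃ H : Fin n → Set (Finset ℕ),
          (∀ i, ∀ t ∈ H i, t ∈ restrictFam F M ∧ M l ≤ elt t 0) ∧
          (∀ i, ∃ y ∈ convexHull ℝ (x '' H i), ‖y - x₀‖ ≤ (1 / 2) ^ l) ∧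
          ∀ t : Fin n → Finset ℕ, (∀ i, t i ∈ H i) → IsPlegma (Fin.append s t) := by
  obtain ⟨x₀, h, hh, hslot⟩ := exists_slots_convexHull_near hF hF₁ hx hM
  have hMh : StrictMono fun n => M (h n) := hM.comp hh
  have hsq : StrictMono fun n : ℕ => n ^ 2 := fun a b hab => Nat.pow_lt_pow_left hab two_ne_zero
  have h0 := empty_notMem_of_isThin hF.thin hF₁
  have hL : StrictMono fun g : ℕ => M (h (g ^ 2)) := hMh.comp hsq
  have hML : ∀ l, M l ≤ M (h (l ^ 2)) := fun l =>
    hM.monotone ((Nat.le_self_pow two_ne_zero l).trans hh.le_apply)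
  refine ⟨x₀, fun g => M (h (g ^ 2)), hL, ?_, hML, ?_⟩
  · rintro _ ⟨g, rfl⟩
    exact ⟨_, rfl⟩
  intro l n k s hn hsL hs hl
  obtain ⟨c, hc, hlc, hc1, hc2⟩ := hs.exists_levels hL hsL hl
  have hcl : ∀ p, l ≤ c p := fun p => hlc.trans (hc.monotone (Nat.zero_le p))
  have hq : ∀ i : ℕ, StrictMono fun p => c p ^ 2 + 1 + i := fun i a b hab => by
    have := hsq (hc hab)
    dsimp only at this ⊢
    omega
  have hne : ∀ i : Fin n, ∀ t ∈ slotFam F M h (fun p => c p ^ 2 + 1 + i), t.Nonempty := by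
    intro i t ht
    rw [Finset.nonempty_iff_ne_empty]
    rintro rfl
    exact h0 ht.1.1
  have hlow : ∀ (i : Fin n) (p : ℕ), M (h (c p ^ 2)) < M (h (c p ^ 2 + 1 + i)) := fun i p =>
    hMh (by omega)
  have hhigh : ∀ (i : Fin n) (p : ℕ),
      M (h (c p ^ 2 + 1 + i + 1)) ≤ M (h ((c p + 1) ^ 2)) := fun i p => by
    refine hMh.monotone ?_
    have h1 := hcl p
    have h2 := i.isLt
    have h3 : (c p + 1) ^ 2 = c p ^ 2 + 2 * c p + 1 := by ring
    omega
  refine ⟨fun i => slotFam F M h fun p => c p ^ 2 + 1 + i, fun i t ht => ⟨ht.1, ?_⟩, fun i => ?_,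
    fun t ht => ?_⟩
  · have h1 : M (h (c 0 ^ 2 + 1 + i)) ≤ elt t 0 := (ht.2 0 (Finset.card_pos.2 (hne i t ht))).1
    have h2 := hlow i 0
    have h3 : M (h (l ^ 2)) ≤ M (h (c 0 ^ 2)) := hL.monotone hlc
    have := hML l
    omega
  · obtain ⟨y, hy, hyn⟩ := hslot _ (hq i)
    refine ⟨y, hy, hyn.trans ?_⟩
    have h1 : l + 1 ≤ c 0 ^ 2 + 1 + i := by
      have := Nat.le_self_pow two_ne_zero (c 0)
      omega
    calc (2 : ℝ) * (1 / 2) ^ (c 0 ^ 2 + 1 + (i : ℕ)) ≤ 2 * (1 / 2) ^ (l + 1) := by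
          gcongr 2 * ?_
          exact pow_le_pow_of_le_one (by norm_num) (by norm_num) h1
      _ = (1 / 2) ^ l := by ring
  · refine hs.append (lo := fun p => M (h (c p ^ 2))) (hi := fun p => M (h ((c p + 1) ^ 2)))
      (fun i => hne i _ (ht i)) (fun p => hL.monotone (hc (Nat.lt_succ_self p))) hc1 hc2
      (fun i p hp => ?_) (fun i j hij p hi hj => ?_)
    · have := (ht i).2 p hp
      exact ⟨(hlow i p).trans_le this.1, this.2.trans_le (hhigh i p)⟩
    · refine ((ht i).2 p hi).2.trans_le (le_trans ?_ ((ht j).2 p hj).1)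
      refine hMh.monotone ?_
      have : (i : ℕ) < j := hij
      dsimp only
      omega

end Extend

section Estimates

variable {X : Type*} [NormedAddCommGroup X] [NormedSpace ℝ X]
variable {E : Type*} [SeminormedAddCommGroup E] [NormedSpace ℝ E]

theorem norm_add_sum_smul_le_of_mem_convexHull {ι : Type*} [Fintype ι] {H : ι → Set X} {y : ι → X}
    (hy : ∀ i, y i ∈ convexHull ℝ (H i)) (b : ι → ℝ) (u : X) {C : ℝ}
    (hC : ∀ z : ι → X, (∀ i, z i ∈ H i) → ‖u + ∑ i, b i • z i‖ ≤ C) :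
    ‖u + ∑ i, b i • y i‖ ≤ C := by
  let T : (ι → X) →ₗ[ℝ] X := ∑ i, b i • LinearMap.proj i
  have hT : ∀ z, T z = ∑ i, b i • z i := fun z => by simp [T, LinearMap.sum_apply]
  have hconv : Convex ℝ {z : ι → X | ‖u + T z‖ ≤ C} := by
    have h := ((convex_closedBall (0 : X) C).translate_preimage_right u).linear_preimage T
    refine (congrArg (Convex ℝ) ?_).mp h
    ext z
    simp only [Set.mem_preimage, mem_closedBall_zero_iff, Set.mem_ofPred_eq]
  have hmem : y ∈ convexHull ℝ (Set.univ.pi H) := mem_convexHull_pi fun i _ => hy i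
  have := convexHull_min (t := {z : ι → X | ‖u + T z‖ ≤ C})
    (fun z hz => by
      simp only [Set.mem_ofPred_eq, hT]
      exact hC z fun i => hz i (Set.mem_univ i)) hconv hmem
  simpa only [Set.mem_ofPred_eq, hT] using this

theorem Generates.exists_bound {F : Set (Finset ℕ)} {x : Finset ℕ → X} {M : ℕ → ℕ} {e : ℕ → E}
    (h : Generates F x M e) :
    ∃ δ : ℕ → ℝ, (∀ l, 0 < δ l) ∧ Tendsto δ atTop (𝓝 0) ∧
      ∀ l K : ℕ, K ≤ l + 1 → ∀ a : Fin K → ℝ, (∀ j, |a j| ≤ 1) → ∀ s : Fin K → Finset ℕ,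
        (∀ j, s j ∈ restrictFam F M) → IsPlegma s → (∀ j, M l ≤ elt (s j) 0) →
          |‖∑ j, a j • x (s j)‖ - ‖∑ j, a j • e (j : ℕ)‖| ≤ δ l := by
  obtain ⟨-, δ, hδ, hδ0, hb⟩ := h
  refine ⟨δ, hδ, hδ0, fun l K hK a ha s hs hp hl => ?_⟩
  cases K with
  | zero => simpa using (hδ l).le
  | succ K =>
    exact hb l K (by omega) a (fun j => abs_le.1 (ha j)) s hs hp (hl 0)

/-- Plegma families in `F ↾ L` extend by plegma families in `F ↾ M` whose members, when averaged,
can be replaced by `x₀`. -/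
theorem exists_extension_estimates {F : Set (Finset ℕ)} (hF : IsRegularThin F)
    (hF₁ : ∃ s ∈ F, s.Nonempty) {x : Finset ℕ → X}
    (hx : IsWRC F x) {M : ℕ → ℕ} (hM : StrictMono M) {e : ℕ → E} (hgen : Generates F x M e) :
    ∃ (x₀ : X) (L : ℕ → ℕ) (δ : ℕ → ℝ), StrictMono L ∧ Tendsto δ atTop (𝓝 0) ∧
      ∀ (m n k : ℕ) (s : Fin k → Finset ℕ), n ≤ m → k + n ≤ m + 1 →
        (∀ j, s j ∈ restrictFam F L) → IsPlegma s → (∀ j, L m ≤ elt (s j) 0) →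
        ∃ t : Fin n → Finset ℕ, ∀ (a : Fin k → ℝ) (b : Fin n → ℝ), (∀ j, |a j| ≤ 1) →
          (∀ i, |b i| ≤ 1) →
          |‖∑ j, a j • x (s j) + ∑ i, b i • x (t i)‖ -
            ‖∑ j, a j • e (j : ℕ) + ∑ i, b i • e (k + i : ℕ)‖| ≤ δ m ∧
          ∀ A : Finset (Fin n),
            ‖∑ j, a j • x (s j) + ∑ i, b i • (if i ∈ A then x₀ else x (t i))‖ ≤
              ‖∑ j, a j • e (j : ℕ) + ∑ i, b i • e (k + i : ℕ)‖ + δ m := by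
  classical
  obtain ⟨x₀, L, hL, hLM, hMleL, hext⟩ := exists_plegma_extension hF hF₁ hx hM
  obtain ⟨δ, hδ, hδ0, hbd⟩ := hgen.exists_bound
  have hlim : Tendsto (fun m : ℕ => δ m + m * (1 / 2 : ℝ) ^ m) atTop (𝓝 0) := by
    have := tendsto_self_mul_const_pow_of_lt_one (r := (1 / 2 : ℝ)) (by norm_num) (by norm_num)
    simpa using hδ0.add this
  refine ⟨x₀, L, _, hL, hlim, fun m n k s hnm hkn hsL hs hsl => ?_⟩
  obtain ⟨H, hH1, hH2, hH3⟩ := hext m n k s hnm hsL hs hsl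
  choose y hy hyn using hH2
  have hne : ∀ i, (H i).Nonempty := fun i => by
    have : (convexHull ℝ (x '' H i)).Nonempty := ⟨_, hy i⟩
    rwa [convexHull_nonempty_iff, Set.image_nonempty] at this
  choose t ht using hne
  have hsM : ∀ j, s j ∈ restrictFam F M := fun j => ⟨(hsL j).1, (hsL j).2.trans hLM⟩
  have hall : ∀ (t : Fin n → Finset ℕ), (∀ i, t i ∈ H i) → ∀ (a : Fin k → ℝ) (b : Fin n → ℝ),
      (∀ j, |a j| ≤ 1) → (∀ i, |b i| ≤ 1) →
      |‖∑ j, a j • x (s j) + ∑ i, b i • x (t i)‖ -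
        ‖∑ j, a j • e (j : ℕ) + ∑ i, b i • e (k + i : ℕ)‖| ≤ δ m := by
    intro t ht a b ha hb
    have := hbd m (k + n) hkn (Fin.append a b) ?_ (Fin.append s t) ?_ (hH3 t ht) ?_
    · simpa only [Fin.sum_univ_add, Fin.append_left, Fin.append_right, Fin.val_castAdd,
        Fin.val_natAdd] using this
    · intro j
      refine Fin.addCases (fun i => ?_) (fun i => ?_) j
      · simpa using ha i
      · simpa using hb i
    · intro j
      refine Fin.addCases (fun i => ?_) (fun i => ?_) j
      · simpa using hsM i
      · simpa using (hH1 i _ (ht i)).1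
    · intro j
      refine Fin.addCases (fun i => ?_) (fun i => ?_) j
      · simpa using (hMleL m).trans (hsl i)
      · simpa using (hH1 i _ (ht i)).2
  have hpos : 0 ≤ (m : ℝ) * (1 / 2 : ℝ) ^ m := by positivity
  refine ⟨t, fun a b ha hb => ⟨(hall t ht a b ha hb).trans (by linarith), fun A => ?_⟩⟩
  have h1 : ‖∑ j, a j • x (s j) + ∑ i, b i • (if i ∈ A then y i else x (t i))‖ ≤
      ‖∑ j, a j • e (j : ℕ) + ∑ i, b i • e (k + i : ℕ)‖ + δ m := by
    refine norm_add_sum_smul_le_of_mem_convexHull (H := fun i => x '' H i) (fun i => ?_) b _ ?_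
    · split_ifs
      · exact hy i
      · exact subset_convexHull ℝ _ ⟨_, ht i, rfl⟩
    · intro z hz
      choose t' ht' htz using hz
      have := abs_le.1 (hall t' ht' a b ha hb)
      simp only [htz] at this
      linarith [this.2]
  have h2 : ‖∑ i, b i • ((if i ∈ A then x₀ else x (t i)) - (if i ∈ A then y i else x (t i)))‖ ≤
      m * (1 / 2 : ℝ) ^ m := by
    calc _ ≤ ∑ i : Fin n, (1 / 2 : ℝ) ^ m := by
          refine norm_sum_le_of_le _ fun i _ => ?_
          rw [norm_smul, Real.norm_eq_abs]
          have : ‖(if i ∈ A then x₀ else x (t i)) - (if i ∈ A then y i else x (t i))‖ ≤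
              (1 / 2 : ℝ) ^ m := by
            split_ifs
            · rw [norm_sub_rev]; exact hyn i
            · simp
          calc _ ≤ 1 * (1 / 2 : ℝ) ^ m := mul_le_mul (hb i) this (norm_nonneg _) zero_le_one
            _ = _ := one_mul _
      _ = n * (1 / 2 : ℝ) ^ m := by simp
      _ ≤ _ := by
        have : (n : ℝ) ≤ m := by exact_mod_cast hnm
        gcongr
  have h3 : ∑ j, a j • x (s j) + ∑ i, b i • (if i ∈ A then x₀ else x (t i)) =
      (∑ j, a j • x (s j) + ∑ i, b i • (if i ∈ A then y i else x (t i))) +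
      ∑ i, b i • ((if i ∈ A then x₀ else x (t i)) - (if i ∈ A then y i else x (t i))) := by
    simp only [smul_sub, Finset.sum_sub_distrib]
    abel
  rw [h3]
  refine (norm_add_le _ _).trans ?_
  linarith

theorem isPlegma_of_fin_zero (s : Fin 0 → Finset ℕ) : IsPlegma s :=
  ⟨fun i => i.elim0, fun i => i.elim0, fun i => i.elim0⟩

theorem exists_smul_abs_le_one {ι : Type*} [Fintype ι] (b : ι → ℝ) :
    ∃ r : ℝ, 0 < r ∧ ∀ i, |r * b i| ≤ 1 := by
  have hnn : 0 ≤ ∑ i, |b i| := Finset.sum_nonneg fun i _ => abs_nonneg _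
  have hpos : 0 < 1 + ∑ i, |b i| := by linarith
  refine ⟨(1 + ∑ i, |b i|)⁻¹, inv_pos.2 hpos, fun i => ?_⟩
  rw [abs_mul, abs_of_pos (inv_pos.2 hpos), inv_mul_le_iff₀ hpos]
  have := Finset.single_le_sum (f := fun i => |b i|) (fun i _ => abs_nonneg _) (Finset.mem_univ i)
  linarith

end Estimates

section Suppression

variable {X : Type*} [NormedAddCommGroup X] [NormedSpace ℝ X]
variable {E : Type*} [SeminormedAddCommGroup E] [NormedSpace ℝ E]

theorem sum_fin_eq_sum_finset {V : Type*} [AddCommMonoid V] [Module ℝ V] {S : Finset ℕ} {n : ℕ}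
    (hS : ∀ i ∈ S, i < n) (b : ℕ → ℝ) (f : ℕ → V) :
    ∑ i : Fin n, (if (i : ℕ) ∈ S then b i else 0) • f i = ∑ i ∈ S, b i • f i := by
  classical
  rw [Fin.sum_univ_eq_sum_range (fun i => (if i ∈ S then b i else 0) • f i) n]
  simp only [ite_smul, zero_smul]
  rw [← Finset.sum_filter]
  congr 1
  ext i
  simp only [Finset.mem_filter, Finset.mem_range]
  exact ⟨fun h => h.2, fun h => ⟨hS i h, h⟩⟩

/-- The hypothesis `h` says that arbitrarily far there are families representing `e` whose members
can be replaced by `x₀` without increasing norms.  Then blocks of coefficients whose sum kills `x₀`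
can be suppressed. -/
theorem suppression_of_replacement {x : Finset ℕ → X} {x₀ : X} {e : ℕ → E} {δ : ℕ → ℝ}
    (hδ : Tendsto δ atTop (𝓝 0))
    (h : ∀ m n : ℕ, n ≤ m → ∃ t : Fin n → Finset ℕ, ∀ b : Fin n → ℝ, (∀ i, |b i| ≤ 1) →
      |‖∑ i, b i • x (t i)‖ - ‖∑ i, b i • e (i : ℕ)‖| ≤ δ m ∧
        ∀ A : Finset (Fin n), ‖∑ i, b i • (if i ∈ A then x₀ else x (t i))‖ ≤
          ‖∑ i, b i • e (i : ℕ)‖ + δ m) :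
    (∀ (S A : Finset ℕ) (b : ℕ → ℝ), A ⊆ S → (∑ i ∈ A, b i) * ‖x₀‖ = 0 →
      ‖∑ i ∈ S \ A, b i • e i‖ ≤ ‖∑ i ∈ S, b i • e i‖) ∧
    ∀ (S : Finset ℕ) (b : ℕ → ℝ), |∑ i ∈ S, b i| * ‖x₀‖ ≤ ‖∑ i ∈ S, b i • e i‖ := by
  classical
  have hscale : ∀ (S : Finset ℕ) (b : ℕ → ℝ), ∃ (n : ℕ) (r : ℝ), 0 < r ∧ (∀ i ∈ S, i < n) ∧
      ∀ i : Fin n, |r * b i| ≤ 1 := by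
    intro S b
    obtain ⟨r, hr, hrb⟩ := exists_smul_abs_le_one (fun i : Fin (S.sup id + 1) => b i)
    exact ⟨_, r, hr, fun i hi => Nat.lt_succ_of_le (Finset.le_sup (f := id) hi), hrb⟩
  have hsm : ∀ (r : ℝ) (S : Finset ℕ) (b : ℕ → ℝ) (f : ℕ → E), 0 < r →
      ‖∑ i ∈ S, (r * b i) • f i‖ = r * ‖∑ i ∈ S, b i • f i‖ := by
    intro r S b f hr
    simp only [mul_smul]
    rw [← Finset.smul_sum, norm_smul, Real.norm_eq_abs, abs_of_pos hr]
  constructor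
  · intro S A b hAS hA
    obtain ⟨n, r, hr, hSn, hrb⟩ := hscale S b
    have key : ∀ m, n ≤ m → ‖∑ i ∈ S \ A, (r * b i) • e i‖ ≤
        ‖∑ i ∈ S, (r * b i) • e i‖ + (δ m + δ m) := by
      intro m hm
      obtain ⟨t, ht⟩ := h m n hm
      have h1 := (ht (fun i => if (i : ℕ) ∈ S \ A then r * b i else 0) ?_).1
      have h2 := (ht (fun i => if (i : ℕ) ∈ S then r * b i else 0) ?_).2
        (Finset.univ.filter fun i : Fin n => (i : ℕ) ∈ A)
      · rw [sum_fin_eq_sum_finset (fun i hi => hSn i (Finset.sdiff_subset hi))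
          (fun i => r * b i) e] at h1
        rw [sum_fin_eq_sum_finset hSn (fun i => r * b i) e] at h2
        have h3 : ∑ i : Fin n, (if (i : ℕ) ∈ S then r * b i else 0) •
            (if i ∈ Finset.univ.filter (fun i : Fin n => (i : ℕ) ∈ A) then x₀ else x (t i)) =
            ∑ i : Fin n, (if (i : ℕ) ∈ S \ A then r * b i else 0) • x (t i) := by
          have h4 : ∑ i : Fin n, (if (i : ℕ) ∈ A then r * b i else 0) • x₀ = 0 := by
            rw [sum_fin_eq_sum_finset (fun i hi => hSn i (hAS hi)) (fun i => r * b i)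
              (fun _ => x₀), ← Finset.sum_smul, ← Finset.mul_sum]
            rcases mul_eq_zero.1 hA with h | h
            · simp [h]
            · simp [norm_eq_zero.1 h]
          rw [← sub_eq_zero, ← Finset.sum_sub_distrib, ← h4]
          refine Finset.sum_congr rfl fun i _ => ?_
          by_cases hiA : (i : ℕ) ∈ A
          · simp [hiA, hAS hiA]
          · simp [hiA]
        rw [h3] at h2
        have := (abs_le.1 h1).1
        linarith
      · intro i
        split_ifs
        · exact hrb i
        · simp
      · intro i
        split_ifs
        · exact hrb i
        · simp
    have hlim : Tendsto (fun m => ‖∑ i ∈ S, (r * b i) • e i‖ + (δ m + δ m)) atTop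
        (𝓝 (‖∑ i ∈ S, (r * b i) • e i‖)) := by
      simpa using (hδ.add hδ).const_add ‖∑ i ∈ S, (r * b i) • e i‖
    have := ge_of_tendsto hlim ((eventually_ge_atTop n).mono key)
    rw [hsm r _ _ _ hr, hsm r _ _ _ hr] at this
    exact le_of_mul_le_mul_left this hr
  · intro S b
    obtain ⟨n, r, hr, hSn, hrb⟩ := hscale S b
    have key : ∀ m, n ≤ m → ‖∑ i ∈ S, (r * b i) • x₀‖ ≤
        ‖∑ i ∈ S, (r * b i) • e i‖ + δ m := by
      intro m hm
      obtain ⟨t, ht⟩ := h m n hm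
      have h2 := (ht (fun i => if (i : ℕ) ∈ S then r * b i else 0) ?_).2 Finset.univ
      · simp only [Finset.mem_univ, if_true] at h2
        rwa [sum_fin_eq_sum_finset hSn (fun i => r * b i) e,
          sum_fin_eq_sum_finset hSn (fun i => r * b i) (fun _ => x₀)] at h2
      · intro i
        split_ifs
        · exact hrb i
        · simp
    have hlim : Tendsto (fun m => ‖∑ i ∈ S, (r * b i) • e i‖ + δ m) atTop
        (𝓝 (‖∑ i ∈ S, (r * b i) • e i‖)) := by
      simpa using hδ.const_add ‖∑ i ∈ S, (r * b i) • e i‖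
    have := ge_of_tendsto hlim ((eventually_ge_atTop n).mono key)
    rw [hsm r _ _ _ hr, ← Finset.sum_smul, ← Finset.mul_sum, norm_smul,
      Real.norm_eq_abs, abs_mul, abs_of_pos hr, mul_assoc] at this
    exact le_of_mul_le_mul_left this hr

theorem suppression_comp {e : ℕ → E} {r : ℝ}
    (h : ∀ (S A : Finset ℕ) (b : ℕ → ℝ), A ⊆ S → (∑ i ∈ A, b i) * r = 0 →
      ‖∑ i ∈ S \ A, b i • e i‖ ≤ ‖∑ i ∈ S, b i • e i‖)
    {ι : Type*} [DecidableEq ι] {κ : ι → ℕ} (hκ : Function.Injective κ) (S A : Finset ι)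
    (b : ι → ℝ) (hAS : A ⊆ S) (hA : (∑ i ∈ A, b i) * r = 0) :
    ‖∑ i ∈ S \ A, b i • e (κ i)‖ ≤ ‖∑ i ∈ S, b i • e (κ i)‖ := by
  have hs : ∀ T : Finset ι, ∑ i ∈ T.image κ, Function.extend κ b 0 i • e i =
      ∑ i ∈ T, b i • e (κ i) := by
    intro T
    rw [Finset.sum_image fun i _ j _ h => hκ h]
    simp only [hκ.extend_apply]
  have := h (S.image κ) (A.image κ) (Function.extend κ b 0) (Finset.image_subset_image hAS) (by
    rw [Finset.sum_image fun i _ j _ h => hκ h]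
    simpa only [hκ.extend_apply] using hA)
  rwa [← Finset.image_sdiff _ _ hκ, hs, hs] at this

theorem IsSpreadingSeq.norm_sum_comp {e : ℕ → E} (he : IsSpreadingSeq e) {σ : ℕ → ℕ}
    (hσ : StrictMono σ) {ι : Type*} (S : Finset ι) (g : ι → ℝ) (κ : ι → ℕ) :
    ‖∑ i ∈ S, g i • e (σ (κ i))‖ = ‖∑ i ∈ S, g i • e (κ i)‖ := by
  classical
  set n := S.sup κ + 1 with hn
  have hS : ∀ i ∈ S, κ i ∈ Finset.range n := fun i hi =>
    Finset.mem_range.2 (Nat.lt_succ_of_le (Finset.le_sup (f := κ) hi))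
  have hsum : ∀ f : ℕ → E, ∑ j : Fin n, (∑ i ∈ S with κ i = j, g i) • f j =
      ∑ i ∈ S, g i • f (κ i) := by
    intro f
    rw [Fin.sum_univ_eq_sum_range (fun j => (∑ i ∈ S with κ i = j, g i) • f j) n,
      ← Finset.sum_fiberwise_of_maps_to hS]
    refine Finset.sum_congr rfl fun j _ => ?_
    rw [Finset.sum_smul]
    refine Finset.sum_congr rfl fun i hi => ?_
    rw [(Finset.mem_filter.1 hi).2]
  have := he n (fun j => ∑ i ∈ S with κ i = j, g i) (fun j => σ j) fun i j hij => hσ hij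
  rw [hsum e, hsum fun j => e (σ j)] at this
  exact this.symm

end Suppression

section Dichotomy

variable {E : Type*} [SeminormedAddCommGroup E] [NormedSpace ℝ E]

theorem IsSpreadingSeq.norm_eq {e : ℕ → E} (he : IsSpreadingSeq e) (n : ℕ) : ‖e n‖ = ‖e 0‖ := by
  have := he.norm_sum_comp (σ := fun i => i + n) (fun a b h => by dsimp only; omega)
    ({0} : Finset ℕ) (fun _ => 1) id
  simpa using this

theorem norm_sum_smul_sub_le_of_suppression {e : ℕ → E} {r : ℝ}
    (h : ∀ (S A : Finset ℕ) (b : ℕ → ℝ), A ⊆ S → (∑ i ∈ A, b i) * r = 0 →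
      ‖∑ i ∈ S \ A, b i • e i‖ ≤ ‖∑ i ∈ S, b i • e i‖) (b : ℕ → ℝ) {S T : Finset ℕ} (hTS : T ⊆ S) :
    ‖∑ i ∈ T, b i • (e (2 * i) - e (2 * i + 1))‖ ≤
      ‖∑ i ∈ S, b i • (e (2 * i) - e (2 * i + 1))‖ := by
  classical
  have hκ : Function.Injective fun p : ℕ × Bool => 2 * p.1 + cond p.2 1 0 := by
    rintro ⟨i, u⟩ ⟨j, w⟩ hij
    cases u <;> cases w <;> simp at hij ⊢ <;> omega
  have hs : ∀ U : Finset ℕ, ∑ p ∈ U ×ˢ (Finset.univ : Finset Bool),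
      (b p.1 * cond p.2 (-1) 1) • e (2 * p.1 + cond p.2 1 0) =
      ∑ i ∈ U, b i • (e (2 * i) - e (2 * i + 1)) := by
    intro U
    rw [Finset.sum_product]
    refine Finset.sum_congr rfl fun i _ => ?_
    simp only [Fintype.sum_bool, cond_true, cond_false, mul_neg, mul_one, neg_smul, smul_sub,
      add_zero]
    abel
  have := suppression_comp h hκ (S ×ˢ Finset.univ) ((S \ T) ×ˢ Finset.univ)
    (fun p => b p.1 * cond p.2 (-1) 1) (Finset.product_subset_product_left Finset.sdiff_subset) (by
      rw [Finset.sum_product]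
      simp)
  have hd : S ×ˢ (Finset.univ : Finset Bool) \ (S \ T) ×ˢ Finset.univ = T ×ˢ Finset.univ := by
    ext ⟨i, u⟩
    simp only [Finset.mem_sdiff, Finset.mem_product, Finset.mem_univ, and_true, not_and, not_not]
    exact ⟨fun h => h.2 h.1, fun h => ⟨hTS h, fun _ => h⟩⟩
  rw [hd] at this
  simpa only [hs] using this

theorem exists_projection_bound_of_lower_bound {e : ℕ → E} (he : IsSpreadingSeq e) {r : ℝ}
    (h : ∀ (S A : Finset ℕ) (b : ℕ → ℝ), A ⊆ S → (∑ i ∈ A, b i) * r = 0 →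
      ‖∑ i ∈ S \ A, b i • e i‖ ≤ ‖∑ i ∈ S, b i • e i‖) {c : ℝ} (hc : 0 < c)
    (hlow : ∀ (n : ℕ) (b : ℕ → ℝ), (∀ i, 0 ≤ b i) → c * ∑ i ∈ Finset.range n, b i ≤
      ‖∑ i ∈ Finset.range n, b i • (e (2 * i) - e (2 * i + 1))‖) :
    ∃ C : ℝ, 1 ≤ C ∧ ∀ (m : ℕ) (A : Finset ℕ), A ⊆ Finset.range m → ∀ a : ℕ → ℝ,
      ‖∑ n ∈ A, a n • e n‖ ≤ C * ‖∑ n ∈ Finset.range m, a n • e n‖ := by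
  classical
  have hlow2 : ∀ (m : ℕ) (a : ℕ → ℝ), c * ∑ i ∈ Finset.range m, |a i| ≤
      4 * ‖∑ i ∈ Finset.range m, a i • e i‖ := by
    intro m a
    have hp : c * ∑ i ∈ Finset.range m, max (a i) 0 ≤
        ‖∑ i ∈ Finset.range m, a i • (e (2 * i) - e (2 * i + 1))‖ := by
      refine (hlow m (fun i => max (a i) 0) fun i => le_max_right _ _).trans (le_trans (le_of_eq ?_)
        (norm_sum_smul_sub_le_of_suppression h a
          (Finset.filter_subset (fun i => 0 ≤ a i) (Finset.range m))))
      rw [Finset.sum_filter]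
      congr 1
      refine Finset.sum_congr rfl fun i _ => ?_
      split_ifs with hi
      · rw [max_eq_left hi]
      · rw [max_eq_right (le_of_not_ge hi), zero_smul]
    have hn : c * ∑ i ∈ Finset.range m, max (-a i) 0 ≤
        ‖∑ i ∈ Finset.range m, a i • (e (2 * i) - e (2 * i + 1))‖ := by
      refine (hlow m (fun i => max (-a i) 0) fun i => le_max_right _ _).trans
        (le_trans (le_of_eq ?_)
        (norm_sum_smul_sub_le_of_suppression h a
          (Finset.filter_subset (fun i => a i ≤ 0) (Finset.range m))))
      rw [Finset.sum_filter, ← norm_neg, ← Finset.sum_neg_distrib]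
      congr 1
      refine Finset.sum_congr rfl fun i _ => ?_
      split_ifs with hi
      · rw [max_eq_left (by linarith), neg_smul, neg_neg]
      · rw [max_eq_right (by linarith), zero_smul, neg_zero]
    have hs : ‖∑ i ∈ Finset.range m, a i • (e (2 * i) - e (2 * i + 1))‖ ≤
        2 * ‖∑ i ∈ Finset.range m, a i • e i‖ := by
      simp only [smul_sub, Finset.sum_sub_distrib]
      refine (norm_sub_le _ _).trans ?_
      have h1 := he.norm_sum_comp (σ := fun i => 2 * i) (fun a b h => by dsimp only; omega)
        (Finset.range m) a id
      have h2 := he.norm_sum_comp (σ := fun i => 2 * i + 1) (fun a b h => by dsimp only; omega)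
        (Finset.range m) a id
      simp only [id] at h1 h2
      rw [h1, h2]
      linarith
    have habs : ∑ i ∈ Finset.range m, |a i| =
        ∑ i ∈ Finset.range m, max (a i) 0 + ∑ i ∈ Finset.range m, max (-a i) 0 := by
      rw [← Finset.sum_add_distrib]
      exact Finset.sum_congr rfl fun i _ => (max_zero_add_max_neg_zero_eq_abs_self (a i)).symm
    rw [habs, mul_add]
    linarith
  refine ⟨max 1 (4 * ‖e 0‖ / c), le_max_left _ _, fun m A hA a => ?_⟩
  have h1 : ‖∑ n ∈ A, a n • e n‖ ≤ ‖e 0‖ * ∑ i ∈ Finset.range m, |a i| := by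
    calc ‖∑ n ∈ A, a n • e n‖ ≤ ∑ n ∈ A, ‖e 0‖ * |a n| := norm_sum_le_of_le _ fun n _ => by
          rw [norm_smul, he.norm_eq, Real.norm_eq_abs, mul_comm]
      _ ≤ ∑ n ∈ Finset.range m, ‖e 0‖ * |a n| :=
          Finset.sum_le_sum_of_subset_of_nonneg hA fun i _ _ => by positivity
      _ = _ := by rw [Finset.mul_sum]
  calc ‖∑ n ∈ A, a n • e n‖ ≤ ‖e 0‖ * ∑ i ∈ Finset.range m, |a i| := h1
    _ = ‖e 0‖ / c * (c * ∑ i ∈ Finset.range m, |a i|) := by field_simp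
    _ ≤ ‖e 0‖ / c * (4 * ‖∑ i ∈ Finset.range m, a i • e i‖) :=
        mul_le_mul_of_nonneg_left (hlow2 m a) (by positivity)
    _ = (4 * ‖e 0‖ / c) * ‖∑ i ∈ Finset.range m, a i • e i‖ := by ring
    _ ≤ _ := mul_le_mul_of_nonneg_right (le_max_right _ _) (norm_nonneg _)

/-- Either all coordinate projections are uniformly bounded, or the differences of consecutive terms
have small convex combinations. -/
theorem exists_projection_bound_or_small_convex {e : ℕ → E} (he : IsSpreadingSeq e) {r : ℝ}
    (hr : 0 ≤ r)
    (h : ∀ (S A : Finset ℕ) (b : ℕ → ℝ), A ⊆ S → (∑ i ∈ A, b i) * r = 0 →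
      ‖∑ i ∈ S \ A, b i • e i‖ ≤ ‖∑ i ∈ S, b i • e i‖) :
    (∃ C : ℝ, 1 ≤ C ∧ ∀ (m : ℕ) (A : Finset ℕ), A ⊆ Finset.range m → ∀ a : ℕ → ℝ,
      ‖∑ n ∈ A, a n • e n‖ ≤ C * ‖∑ n ∈ Finset.range m, a n • e n‖) ∨
    (0 < r ∧ ∀ ε : ℝ, 0 < ε → ∃ (n : ℕ) (b : ℕ → ℝ), (∀ i, 0 ≤ b i) ∧
      ∑ i ∈ Finset.range n, b i = 1 ∧
      ‖∑ i ∈ Finset.range n, b i • (e (2 * i) - e (2 * i + 1))‖ ≤ ε) := by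
  rcases hr.eq_or_lt with rfl | hr
  · refine Or.inl ⟨1, le_rfl, fun m A hA a => ?_⟩
    have := h (Finset.range m) (Finset.range m \ A) a Finset.sdiff_subset (mul_zero _)
    rwa [Finset.sdiff_sdiff_eq_self hA, ← one_mul ‖∑ i ∈ Finset.range m, a i • e i‖] at this
  by_cases hl : ∃ c : ℝ, 0 < c ∧ ∀ (n : ℕ) (b : ℕ → ℝ), (∀ i, 0 ≤ b i) →
      c * ∑ i ∈ Finset.range n, b i ≤
        ‖∑ i ∈ Finset.range n, b i • (e (2 * i) - e (2 * i + 1))‖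
  · obtain ⟨c, hc, hlow⟩ := hl
    exact Or.inl (exists_projection_bound_of_lower_bound he h hc hlow)
  · push Not at hl
    refine Or.inr ⟨hr, fun ε hε => ?_⟩
    obtain ⟨n, b, hb, hlt⟩ := hl ε hε
    set s := ∑ i ∈ Finset.range n, b i with hs
    have hspos : 0 < s := by
      by_contra hs0
      have : ε * s ≤ 0 := mul_nonpos_of_nonneg_of_nonpos hε.le (not_lt.1 hs0)
      linarith [norm_nonneg (∑ i ∈ Finset.range n, b i • (e (2 * i) - e (2 * i + 1)))]
    refine ⟨n, fun i => s⁻¹ * b i, fun i => mul_nonneg (inv_nonneg.2 hspos.le) (hb i), ?_, ?_⟩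
    · rw [← Finset.mul_sum, ← hs, inv_mul_cancel₀ hspos.ne']
    · simp only [mul_smul]
      rw [← Finset.smul_sum, norm_smul, Real.norm_eq_abs, abs_of_pos (inv_pos.2 hspos),
        inv_mul_le_iff₀ hspos, mul_comm s]
      exact hlt.le

theorem norm_convex_sub_convex_le_of_disjoint {e : ℕ → E} (he : IsSpreadingSeq e) {r : ℝ}
    (h : ∀ (S A : Finset ℕ) (b : ℕ → ℝ), A ⊆ S → (∑ i ∈ A, b i) * r = 0 →
      ‖∑ i ∈ S \ A, b i • e i‖ ≤ ‖∑ i ∈ S, b i • e i‖) {n : ℕ} {b : ℕ → ℝ} {ε : ℝ}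
    (hb : ‖∑ i ∈ Finset.range n, b i • (e (2 * i) - e (2 * i + 1))‖ ≤ ε) {k l : ℕ → ℕ}
    (hk : StrictMono k) (hl : StrictMono l) (hkl : ∀ i j, k i ≠ l j) :
    ‖∑ i ∈ Finset.range n, b i • (e (k i) - e (l i))‖ ≤ 2 * ε := by
  classical
  let κ : ℕ × Bool × Bool → ℕ := fun p => 2 * (cond p.2.1 (l p.1) (k p.1)) + cond p.2.2 1 0
  let β : ℕ × Bool × Bool → ℝ := fun p => b p.1 * cond p.2.1 (-1) 1 * cond p.2.2 (-1) 1
  have hκ : Function.Injective κ := by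
    rintro ⟨i, u, w⟩ ⟨j, u', w'⟩ hij
    have hij' : i = j ∧ u = u' ∧ w = w' := by
      have h1 := hkl i j
      have h2 := hkl j i
      cases u <;> cases w <;> cases u' <;> cases w' <;> simp [κ] at hij ⊢ <;>
        first
        | omega
        | exact hk.injective (by omega)
        | exact hl.injective (by omega)
    obtain ⟨rfl, rfl, rfl⟩ := hij'
    rfl
  have hpair : ∀ q : ℕ → ℕ, StrictMono q →
      ‖∑ i ∈ Finset.range n, b i • (e (2 * q i) - e (2 * q i + 1))‖ ≤ ε := by
    intro q hq
    have hσ : StrictMono fun x => 2 * q (x / 2) + x % 2 := by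
      intro a c hac
      have hle : a / 2 ≤ c / 2 := Nat.div_le_div_right hac.le
      rcases hle.lt_or_eq with hlt | heq
      · have := hq hlt
        dsimp only
        omega
      · dsimp only
        rw [heq]
        omega
    have := he.norm_sum_comp hσ (Finset.range n ×ˢ (Finset.univ : Finset Bool))
      (fun p => b p.1 * cond p.2 (-1) 1) (fun p => 2 * p.1 + cond p.2 1 0)
    rw [Finset.sum_product, Finset.sum_product] at this
    have h1 : ∀ i, (2 * i + 1) / 2 = i := fun i => by omega
    have h2 : ∀ i, (2 * i + 1) % 2 = 1 := fun i => by omega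
    simp only [Fintype.sum_bool, cond_true, cond_false, mul_neg, mul_one, neg_smul,
      add_zero, h1, h2, Nat.mul_div_cancel_left _ two_pos, Nat.mul_mod_right, neg_add_eq_sub,
      ← smul_sub] at this
    rw [this]
    exact hb
  have hsup := suppression_comp h hκ (Finset.range n ×ˢ Finset.univ ×ˢ Finset.univ)
    (Finset.range n ×ˢ Finset.univ ×ˢ {true}) β (by
      refine Finset.product_subset_product_right (Finset.product_subset_product_right ?_)
      simp) (by
      simp only [Finset.sum_product, β]
      simp)
  have hd : Finset.range n ×ˢ (Finset.univ : Finset Bool) ×ˢ (Finset.univ : Finset Bool) \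
      Finset.range n ×ˢ Finset.univ ×ˢ {true} = Finset.range n ×ˢ Finset.univ ×ˢ {false} := by
    ext ⟨i, u, w⟩
    cases w <;> simp
  rw [hd] at hsup
  simp only [Finset.sum_product, β, κ, Fintype.sum_bool, cond_true, cond_false, mul_neg, mul_one,
    neg_smul, add_zero, Finset.sum_singleton, neg_add_eq_sub, ← smul_sub] at hsup
  have h1 := he.norm_sum_comp (σ := fun i => 2 * i) (fun a b h => by dsimp only; omega)
    (Finset.range n ×ˢ (Finset.univ : Finset Bool)) (fun p => b p.1 * cond p.2 (-1) 1)
    (fun p => cond p.2 (l p.1) (k p.1))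
  simp only [Finset.sum_product, Fintype.sum_bool, cond_true, cond_false, mul_neg, mul_one,
    neg_smul, neg_add_eq_sub, ← smul_sub] at h1
  rw [← h1]
  refine hsup.trans ?_
  rw [show (2 : ℝ) * ε = ε + ε by ring]
  refine le_trans (le_of_eq ?_) ((norm_sub_le _ _).trans (add_le_add (hpair k hk) (hpair l hl)))
  rw [← Finset.sum_sub_distrib]
  simp only [smul_sub]

theorem norm_convex_sub_convex_le {e : ℕ → E} (he : IsSpreadingSeq e) {r : ℝ}
    (h : ∀ (S A : Finset ℕ) (b : ℕ → ℝ), A ⊆ S → (∑ i ∈ A, b i) * r = 0 →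
      ‖∑ i ∈ S \ A, b i • e i‖ ≤ ‖∑ i ∈ S, b i • e i‖) {n : ℕ} {b : ℕ → ℝ} {ε : ℝ}
    (hb : ‖∑ i ∈ Finset.range n, b i • (e (2 * i) - e (2 * i + 1))‖ ≤ ε) {k l : ℕ → ℕ}
    (hk : StrictMono k) (hl : StrictMono l) :
    ‖∑ i ∈ Finset.range n, b i • e (k i) - ∑ i ∈ Finset.range n, b i • e (l i)‖ ≤ 4 * ε := by
  have h2 : StrictMono fun i : ℕ => 2 * i := fun a b h => by dsimp only; omega
  have h3 : StrictMono fun i : ℕ => 2 * i + 1 := fun a b h => by dsimp only; omega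
  have h1 := he.norm_sum_comp h2
    (Finset.range n ×ˢ (Finset.univ : Finset Bool)) (fun p => b p.1 * cond p.2 (-1) 1)
    (fun p => cond p.2 (l p.1) (k p.1))
  simp only [Finset.sum_product, Fintype.sum_bool, cond_true, cond_false, mul_neg, mul_one,
    neg_smul, neg_add_eq_sub, Finset.sum_sub_distrib] at h1
  rw [← h1]
  have hk' := norm_convex_sub_convex_le_of_disjoint he h hb (h2.comp hk) h3
    (fun i j => by dsimp only [Function.comp]; omega)
  have hl' := norm_convex_sub_convex_le_of_disjoint he h hb (h2.comp hl) h3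
    (fun i j => by dsimp only [Function.comp]; omega)
  simp only [smul_sub, Finset.sum_sub_distrib, Function.comp] at hk' hl'
  rw [show (4 : ℝ) * ε = 2 * ε + 2 * ε by ring]
  refine le_trans (le_of_eq ?_) ((norm_sub_le _ _).trans (add_le_add hk' hl'))
  congr 1
  abel

/-- `v` is the uniform limit of convex combinations of subsequences of `e`. -/
def IsConvexLimit (e : ℕ → E) (v : UniformSpace.Completion E) : Prop :=
  ∀ ε : ℝ, 0 < ε → ∃ (n : ℕ) (b : ℕ → ℝ), (∀ i, 0 ≤ b i) ∧ ∑ i ∈ Finset.range n, b i = 1 ∧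
    ∀ k : ℕ → ℕ, StrictMono k →
      ‖∑ i ∈ Finset.range n, b i • (e (k i) : UniformSpace.Completion E) - v‖ ≤ ε

theorem norm_sum_smul_le_of_convex {ι : Type*} {S : Finset ι} {b : ι → ℝ} (hb : ∀ i, 0 ≤ b i)
    (hb1 : ∑ i ∈ S, b i = 1) {y : ι → E} {C : ℝ} (hy : ∀ i, ‖y i‖ ≤ C) :
    ‖∑ i ∈ S, b i • y i‖ ≤ C := by
  calc _ ≤ ∑ i ∈ S, b i * C := norm_sum_le_of_le _ fun i _ => by
        rw [norm_smul, Real.norm_eq_abs, abs_of_nonneg (hb i)]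
        exact mul_le_mul_of_nonneg_left (hy i) (hb i)
    _ = C := by rw [← Finset.sum_mul, hb1, one_mul]

theorem exists_isConvexLimit {e : ℕ → E} (he : IsSpreadingSeq e) {r : ℝ}
    (h : ∀ (S A : Finset ℕ) (b : ℕ → ℝ), A ⊆ S → (∑ i ∈ A, b i) * r = 0 →
      ‖∑ i ∈ S \ A, b i • e i‖ ≤ ‖∑ i ∈ S, b i • e i‖)
    (hsmall : ∀ ε : ℝ, 0 < ε → ∃ (n : ℕ) (b : ℕ → ℝ), (∀ i, 0 ≤ b i) ∧
      ∑ i ∈ Finset.range n, b i = 1 ∧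
      ‖∑ i ∈ Finset.range n, b i • (e (2 * i) - e (2 * i + 1))‖ ≤ ε) :
    ∃ v : UniformSpace.Completion E, IsConvexLimit e v := by
  have hpos : ∀ m : ℕ, (0 : ℝ) < 1 / (m + 1) := fun m => Nat.one_div_pos_of_nat
  choose n b hb hb1 hbs using fun m : ℕ => hsmall (1 / (m + 1)) (hpos m)
  have hmid : ∀ (m m' : ℕ) (k : ℕ → ℕ), StrictMono k →
      ‖∑ i ∈ Finset.range (n m), b m i • e (k i) - ∑ j ∈ Finset.range (n m'), b m' j •
        ∑ i ∈ Finset.range (n m), b m i • e (i + j)‖ ≤ 4 * (1 / (m + 1)) := by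
    intro m m' k hk
    have h1 : ∑ i ∈ Finset.range (n m), b m i • e (k i) = ∑ j ∈ Finset.range (n m'), b m' j •
        ∑ i ∈ Finset.range (n m), b m i • e (k i) := by
      rw [← Finset.sum_smul, hb1, one_smul]
    rw [h1, ← Finset.sum_sub_distrib]
    simp only [← smul_sub]
    exact norm_sum_smul_le_of_convex (hb m') (hb1 m') fun j =>
      norm_convex_sub_convex_le he h (hbs m) hk fun a b h => by omega
  have hcomm : ∀ m m' : ℕ, ∑ j ∈ Finset.range (n m'), b m' j •
        ∑ i ∈ Finset.range (n m), b m i • e (i + j) = ∑ j ∈ Finset.range (n m), b m j •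
        ∑ i ∈ Finset.range (n m'), b m' i • e (i + j) := by
    intro m m'
    simp only [Finset.smul_sum]
    rw [Finset.sum_comm]
    refine Finset.sum_congr rfl fun i _ => Finset.sum_congr rfl fun j _ => ?_
    rw [smul_comm, add_comm]
  have hdist : ∀ (m m' : ℕ) (k l : ℕ → ℕ), StrictMono k → StrictMono l →
      ‖∑ i ∈ Finset.range (n m), b m i • e (k i) - ∑ i ∈ Finset.range (n m'), b m' i • e (l i)‖ ≤
        4 * (1 / (m + 1)) + 4 * (1 / (m' + 1)) := by
    intro m m' k l hk hl
    have h1 := hmid m m' k hk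
    have h2 := hmid m' m l hl
    rw [← hcomm m m'] at h2
    refine le_trans (le_of_eq ?_) ((norm_sub_le _ _).trans (add_le_add h1 h2))
    congr 1
    abel
  let J : E →ₗᵢ[ℝ] UniformSpace.Completion E := UniformSpace.Completion.toComplₗᵢ
  let w : ℕ → UniformSpace.Completion E := fun m =>
    J (∑ i ∈ Finset.range (n m), b m i • e i)
  have hw : ∀ (m m' : ℕ) (k : ℕ → ℕ), StrictMono k →
      ‖J (∑ i ∈ Finset.range (n m), b m i • e (k i)) - w m'‖ ≤
        4 * (1 / (m + 1)) + 4 * (1 / (m' + 1)) := by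
    intro m m' k hk
    rw [← map_sub, J.norm_map]
    exact hdist m m' k id hk strictMono_id
  have hcauchy : CauchySeq w := by
    refine cauchySeq_of_le_tendsto_0 (fun N : ℕ => 8 * (1 / ((N : ℝ) + 1))) (fun m m' N hm hm' => ?_)
      ?_
    · rw [dist_eq_norm]
      refine (hw m m' id strictMono_id).trans ?_
      have h1 : (1 : ℝ) / (m + 1) ≤ 1 / (N + 1) := Nat.one_div_le_one_div hm
      have h2 : (1 : ℝ) / (m' + 1) ≤ 1 / (N + 1) := Nat.one_div_le_one_div hm'
      linarith
    · simpa using (tendsto_one_div_add_atTop_nhds_zero_nat (𝕜 := ℝ)).const_mul 8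
  obtain ⟨v, hv⟩ := cauchySeq_tendsto_of_complete hcauchy
  refine ⟨v, fun ε hε => ?_⟩
  obtain ⟨m, hm⟩ := exists_nat_one_div_lt (K := ℝ) (show 0 < ε / 4 by linarith)
  refine ⟨n m, b m, hb m, hb1 m, fun k hk => ?_⟩
  have hlim1 : Tendsto (fun m' => ‖J (∑ i ∈ Finset.range (n m), b m i • e (k i)) - w m'‖) atTop
      (𝓝 ‖J (∑ i ∈ Finset.range (n m), b m i • e (k i)) - v‖) :=
    (hv.const_sub _).norm
  have hlim2 : Tendsto (fun m' : ℕ => 4 * ((1 : ℝ) / (m + 1)) + 4 * (1 / ((m' : ℝ) + 1))) atTop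
      (𝓝 (4 * ((1 : ℝ) / (m + 1)))) := by
    simpa using ((tendsto_one_div_add_atTop_nhds_zero_nat (𝕜 := ℝ)).const_mul 4).const_add
      (4 * ((1 : ℝ) / (m + 1)))
  have := le_of_tendsto_of_tendsto' hlim1 hlim2 fun m' => hw m m' k hk
  rw [map_sum] at this
  simp only [map_smul] at this
  exact this.trans (by linarith)

end Dichotomy

section ConvexLimit

variable {E : Type*} [SeminormedAddCommGroup E] [NormedSpace ℝ E]

theorem tendsto_toWeakSpace {V : Type*} [NormedAddCommGroup V] [NormedSpace ℝ V] {y : ℕ → V} {v : V}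
    (h : ∀ f : StrongDual ℝ V, Tendsto (fun n => f (y n)) atTop (𝓝 (f v))) :
    Tendsto (fun n => toWeakSpace ℝ V (y n)) atTop (𝓝 (toWeakSpace ℝ V v)) := by
  have hind : Topology.IsInducing (fun (w : WeakSpace ℝ V) (f : StrongDual ℝ V) =>
    (topDualPairing ℝ V).flip w f) := ⟨rfl⟩
  rw [hind.tendsto_nhds_iff, tendsto_pi_nhds]
  exact h

theorem IsConvexLimit.tendsto_dual {e : ℕ → E} {v : UniformSpace.Completion E}
    (h : IsConvexLimit e v) (f : StrongDual ℝ (UniformSpace.Completion E)) :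
    Tendsto (fun n => f (e n : UniformSpace.Completion E)) atTop (𝓝 (f v)) := by
  have key : ∀ (f : StrongDual ℝ (UniformSpace.Completion E)) (η : ℝ), 0 < η →
      ∀ᶠ n in atTop, f (e n : UniformSpace.Completion E) < f v + η := by
    intro f η hη
    by_contra hcon
    rw [not_eventually] at hcon
    obtain ⟨k, hk, hkf⟩ := extraction_of_frequently_atTop hcon
    have hpos : 0 < ‖f‖ + 1 := by positivity
    obtain ⟨n, b, hb, hb1, hbk⟩ := h (η / 2 / (‖f‖ + 1)) (by positivity)
    have h1 := hbk k hk
    have h2 : η ≤ f (∑ i ∈ Finset.range n, b i • (e (k i) : UniformSpace.Completion E) - v) := by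
      rw [map_sub, map_sum]
      simp only [map_smul, smul_eq_mul]
      have : ∑ i ∈ Finset.range n, b i * (f v + η) ≤
          ∑ i ∈ Finset.range n, b i * f (e (k i) : UniformSpace.Completion E) :=
        Finset.sum_le_sum fun i _ => mul_le_mul_of_nonneg_left (not_lt.1 (hkf i)) (hb i)
      rw [← Finset.sum_mul, hb1, one_mul] at this
      linarith
    have h3 : f (∑ i ∈ Finset.range n, b i • (e (k i) : UniformSpace.Completion E) - v) ≤
        (‖f‖ + 1) * (η / 2 / (‖f‖ + 1)) := by
      refine (le_abs_self _).trans ((f.le_opNorm _).trans ?_)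
      exact mul_le_mul (by linarith) h1 (norm_nonneg _) hpos.le
    rw [mul_div_cancel₀ _ hpos.ne'] at h3
    linarith
  rw [Metric.tendsto_nhds]
  intro η hη
  filter_upwards [key f η hη, key (-f) η hη] with n h1 h2
  simp only [_root_.neg_apply] at h2
  rw [Real.dist_eq, abs_lt]
  constructor <;> linarith

theorem IsConvexLimit.mem_topologicalClosure {e : ℕ → E} {v : UniformSpace.Completion E}
    (h : IsConvexLimit e v) : v ∈ (Submodule.span ℝ
      (Set.range fun n => (e n : UniformSpace.Completion E))).topologicalClosure := by
  rw [← SetLike.mem_coe, Submodule.topologicalClosure_coe, Metric.mem_closure_iff]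
  intro ε hε
  obtain ⟨n, b, -, -, hbk⟩ := h (ε / 2) (by positivity)
  refine ⟨∑ i ∈ Finset.range n, b i • (e i : UniformSpace.Completion E), ?_, ?_⟩
  · exact Submodule.sum_mem _ fun i _ => Submodule.smul_mem _ _ (Submodule.subset_span ⟨i, rfl⟩)
  · rw [dist_comm, dist_eq_norm]
    exact (hbk id strictMono_id).trans_lt (by linarith)

theorem IsConvexLimit.not_isSchauderBasic {e : ℕ → E} {v : UniformSpace.Completion E}
    (h : IsConvexLimit e v) {r : ℝ} (hr : 0 < r)
    (hlow : ∀ (S : Finset ℕ) (b : ℕ → ℝ), |∑ i ∈ S, b i| * r ≤ ‖∑ i ∈ S, b i • e i‖) :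
    ¬ IsSchauderBasic e := by
  rintro ⟨-, C, hC, hproj⟩
  obtain ⟨n, b, hb, hb1, hbk⟩ := h (r / (4 * C)) (by positivity)
  let a : ℕ → ℝ := fun i => if i < n then b i else -b (i - n)
  have ha1 : ∑ i ∈ Finset.range n, a i • e i = ∑ i ∈ Finset.range n, b i • e i :=
    Finset.sum_congr rfl fun i hi => by simp only [a, if_pos (Finset.mem_range.1 hi)]
  have ha2 : ∑ i ∈ Finset.range (n + n), a i • e i =
      ∑ i ∈ Finset.range n, b i • e i - ∑ i ∈ Finset.range n, b i • e (n + i) := by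
    rw [Finset.sum_range_add, ha1, sub_eq_add_neg, ← Finset.sum_neg_distrib]
    simp [a]
  have h1 := hproj n (n + n) (by omega) a
  rw [ha1, ha2] at h1
  have h2 := hlow (Finset.range n) b
  rw [hb1, abs_one, one_mul] at h2
  have h3 : ‖∑ i ∈ Finset.range n, b i • e i - ∑ i ∈ Finset.range n, b i • e (n + i)‖ ≤
      r / (4 * C) + r / (4 * C) := by
    let J : E →ₗᵢ[ℝ] UniformSpace.Completion E := UniformSpace.Completion.toComplₗᵢ
    rw [← J.norm_map, map_sub, map_sum, map_sum]
    simp only [map_smul]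
    refine le_trans (le_of_eq ?_) ((norm_sub_le _ _).trans (add_le_add (hbk id strictMono_id)
      (hbk (fun i => n + i) fun a b h => by dsimp only; omega)))
    congr 1
    simp [J]
  have h4 : C * (r / (4 * C) + r / (4 * C)) = r / 2 := by field_simp; norm_num
  have h5 := mul_le_mul_of_nonneg_left h3 (zero_le_one.trans hC)
  linarith

/-- Subtracting the limit from a spreading sequence leaves it spreading. -/
theorem IsConvexLimit.norm_sum_comp_sub {e : ℕ → E} (he : IsSpreadingSeq e)
    {v : UniformSpace.Completion E} (h : IsConvexLimit e v) {σ : ℕ → ℕ} (hσ : StrictMono σ)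
    (S : Finset ℕ) (g : ℕ → ℝ) :
    ‖∑ i ∈ S, g i • ((e (σ i) : UniformSpace.Completion E) - v)‖ =
      ‖∑ i ∈ S, g i • ((e i : UniformSpace.Completion E) - v)‖ := by
  classical
  set G := ∑ i ∈ S, g i with hG
  refine eq_of_forall_dist_le fun ε hε => ?_
  obtain ⟨n, b, hb, hb1, hbk⟩ := h (ε / (2 * (|G| + 1))) (by positivity)
  have happrox : ∀ τ : ℕ → ℕ, StrictMono τ →
      |‖∑ i ∈ S, g i • ((e (τ i) : UniformSpace.Completion E) - v)‖ -
        ‖∑ i ∈ S, g i • e (τ i) - G • ∑ i ∈ Finset.range n, b i • e (τ i)‖| ≤ ε / 2 := by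
    intro τ hτ
    let J : E →ₗᵢ[ℝ] UniformSpace.Completion E := UniformSpace.Completion.toComplₗᵢ
    have h1 : J (∑ i ∈ S, g i • e (τ i) - G • ∑ i ∈ Finset.range n, b i • e (τ i)) =
        ∑ i ∈ S, g i • (e (τ i) : UniformSpace.Completion E) -
        G • ∑ i ∈ Finset.range n, b i • (e (τ i) : UniformSpace.Completion E) := by
      simp only [map_sub, map_sum, map_smul]
      rfl
    rw [← J.norm_map, h1]
    refine (abs_norm_sub_norm_le _ _).trans ?_
    have h2 : ∑ i ∈ S, g i • ((e (τ i) : UniformSpace.Completion E) - v) -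
        (∑ i ∈ S, g i • (e (τ i) : UniformSpace.Completion E) -
        G • ∑ i ∈ Finset.range n, b i • (e (τ i) : UniformSpace.Completion E)) =
        G • (∑ i ∈ Finset.range n, b i • (e (τ i) : UniformSpace.Completion E) - v) := by
      simp only [smul_sub, Finset.sum_sub_distrib, ← Finset.sum_smul, hG]
      abel
    rw [h2, norm_smul, Real.norm_eq_abs]
    calc |G| * _ ≤ (|G| + 1) * (ε / (2 * (|G| + 1))) :=
          mul_le_mul (by linarith) (hbk τ hτ) (norm_nonneg _) (by positivity)
      _ = ε / 2 := by field_simp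
  have h1 := happrox σ hσ
  have h2 := happrox id strictMono_id
  have h3 : ‖∑ i ∈ S, g i • e (σ i) - G • ∑ i ∈ Finset.range n, b i • e (σ i)‖ =
      ‖∑ i ∈ S, g i • e i - G • ∑ i ∈ Finset.range n, b i • e i‖ := by
    have := he.norm_sum_comp hσ (S.disjSum (Finset.range n))
      (Sum.elim g fun i => -(G * b i)) (Sum.elim id id)
    simpa only [Finset.sum_disjSum, Sum.elim_inl, Sum.elim_inr, id, neg_smul, mul_smul,
      Finset.sum_neg_distrib, ← Finset.smul_sum, ← sub_eq_add_neg] using this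
  rw [h3] at h1
  simp only [id] at h2
  rw [Real.dist_eq]
  rw [abs_le] at h1 h2 ⊢
  constructor <;> linarith [h1.1, h1.2, h2.1, h2.2]

theorem IsSpreadingSeq.isTrivialSeq_of_succ {e : ℕ → E} (he : IsSpreadingSeq e) {i : ℕ}
    (h : ‖e i - e (i + 1)‖ = 0) : IsTrivialSeq e := by
  have key : ∀ n m, n < m → ‖e n - e m‖ = 0 := by
    intro n m hnm
    have h1 := he 2 ![1, -1] ![n, m] (fun a b hab => by
      fin_cases a <;> fin_cases b <;> simp at hab ⊢
      omega)
    have h2 := he 2 ![1, -1] ![i, i + 1] (fun a b hab => by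
      fin_cases a <;> fin_cases b <;> simp at hab ⊢)
    rw [h1] at h2
    simp only [Fin.sum_univ_two, Matrix.cons_val_zero, Matrix.cons_val_one, one_smul,
      neg_smul, ← sub_eq_add_neg] at h2
    rw [h2, h]
  intro n m
  rcases lt_trichotomy n m with h | rfl | h
  · exact key n m h
  · simp
  · rw [norm_sub_rev]; exact key m n h

theorem IsConvexLimit.linearIndependent_sub {e : ℕ → E} (he : IsSpreadingSeq e)
    (hnt : ¬ IsTrivialSeq e) {v : UniformSpace.Completion E} (h : IsConvexLimit e v) :
    LinearIndependent ℝ fun n => (e n : UniformSpace.Completion E) - v := by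
  rw [linearIndependent_iff']
  intro S g hg i₀ hi₀
  have h0 : ∀ σ : ℕ → ℕ, StrictMono σ →
      ∑ i ∈ S, g i • ((e (σ i) : UniformSpace.Completion E) - v) = 0 := by
    intro σ hσ
    rw [← norm_eq_zero, h.norm_sum_comp_sub he hσ, hg, norm_zero]
  have h1 := h0 (fun i => if i ≤ i₀ then i else i + 1) (fun a b hab => by
    dsimp only; split_ifs <;> omega)
  have h2 := h0 (fun i => if i < i₀ then i else i + 1) (fun a b hab => by
    dsimp only; split_ifs <;> omega)
  have h3 : g i₀ • ((e i₀ : UniformSpace.Completion E) - (e (i₀ + 1) :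
      UniformSpace.Completion E)) = 0 := by
    have h4 := sub_eq_zero.2 (h1.trans h2.symm)
    rw [← Finset.sum_sub_distrib, Finset.sum_eq_single_of_mem i₀ hi₀] at h4
    · simpa only [le_refl, if_true, lt_irrefl, if_false, ← smul_sub, sub_sub_sub_cancel_right]
        using h4
    · intro j _ hj
      by_cases hj' : j < i₀
      · simp [hj', hj'.le]
      · have : ¬ j ≤ i₀ := by omega
        simp [hj', this]
  rcases smul_eq_zero.1 h3 with h3 | h3
  · exact h3
  · refine absurd (he.isTrivialSeq_of_succ (i := i₀) ?_) hnt
    rw [← UniformSpace.Completion.norm_coe, UniformSpace.Completion.coe_sub, h3, norm_zero]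

end ConvexLimit

section Decomposition

variable {X : Type*} [NormedAddCommGroup X] [NormedSpace ℝ X]
variable {E : Type*} [SeminormedAddCommGroup E] [NormedSpace ℝ E]

theorem IsConvexLimit.eventually_norm_near {F : Set (Finset ℕ)} {x : Finset ℕ → X} {x₀ : X}
    {L : ℕ → ℕ} {δ : ℕ → ℝ} (hδ : Tendsto δ atTop (𝓝 0)) {e : ℕ → E}
    (hU : ∀ (m n k : ℕ) (s : Fin k → Finset ℕ), n ≤ m → k + n ≤ m + 1 →
        (∀ j, s j ∈ restrictFam F L) → IsPlegma s → (∀ j, L m ≤ elt (s j) 0) →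
        ∃ t : Fin n → Finset ℕ, ∀ (a : Fin k → ℝ) (b : Fin n → ℝ), (∀ j, |a j| ≤ 1) →
          (∀ i, |b i| ≤ 1) →
          |‖∑ j, a j • x (s j) + ∑ i, b i • x (t i)‖ -
            ‖∑ j, a j • e (j : ℕ) + ∑ i, b i • e (k + i : ℕ)‖| ≤ δ m ∧
          ∀ A : Finset (Fin n),
            ‖∑ j, a j • x (s j) + ∑ i, b i • (if i ∈ A then x₀ else x (t i))‖ ≤
              ‖∑ j, a j • e (j : ℕ) + ∑ i, b i • e (k + i : ℕ)‖ + δ m)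
    {v : UniformSpace.Completion E} (h : IsConvexLimit e v) (K : ℕ) {η : ℝ} (hη : 0 < η) :
    ∀ᶠ m in atTop, ∀ (k : ℕ) (a : Fin k → ℝ) (r : ℝ) (s : Fin k → Finset ℕ), k ≤ K →
      (∀ j, |a j| ≤ 1) → |r| ≤ K → (∀ j, s j ∈ restrictFam F L) → IsPlegma s →
      (∀ j, L m ≤ elt (s j) 0) →
      |‖∑ j, a j • x (s j) + r • x₀‖ -
        ‖∑ j, a j • (e (j : ℕ) : UniformSpace.Completion E) + r • v‖| ≤ η := by
  classical
  set R : ℝ := K + 1 with hR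
  have hRpos : 0 < R := by positivity
  set ε : ℝ := η / (5 * R) with hε
  have hεpos : 0 < ε := by positivity
  obtain ⟨n, b, hb, hb1, hbk⟩ := h ε hεpos
  have hble : ∀ i : Fin n, |b i| ≤ 1 := fun i => by
    rw [abs_of_nonneg (hb i), ← hb1]
    exact Finset.single_le_sum (fun i _ => hb i) (Finset.mem_range.2 i.isLt)
  have hδε : ∀ᶠ m in atTop, δ m < ε := hδ.eventually_lt_const hεpos
  filter_upwards [hδε, eventually_ge_atTop (n + n + K)] with m hm1 hm2 k a r s hk ha hr hsL hs hsl
  obtain ⟨t, ht⟩ := hU m (n + n) k s (by omega) (by omega) hsL hs hsl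
  let J : E →ₗᵢ[ℝ] UniformSpace.Completion E := UniformSpace.Completion.toComplₗᵢ
  have hJ : ∀ y : E, J y = (y : UniformSpace.Completion E) := fun y => rfl
  have hbk' : ∀ c : ℕ, ‖J (∑ i : Fin n, b i • e (c + i)) - v‖ ≤ ε := by
    intro c
    rw [Fin.sum_univ_eq_sum_range (fun i => b i • e (c + i)) n, map_sum]
    simp only [map_smul, hJ (e _)]
    exact hbk (fun i => c + i) fun a b h => by dsimp only; omega
  set y := ∑ i : Fin n, b i • x (t (Fin.castAdd n i)) with hy
  have hyx : ‖y - x₀‖ ≤ 3 * ε := by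
    have h1 := (ht (fun _ => 0) (Fin.append (fun i => b i) fun i => -b i) (by simp) (fun i => by
      refine Fin.addCases (fun i => ?_) (fun i => ?_) i
      · simpa only [Fin.append_left] using hble i
      · simpa only [Fin.append_right, abs_neg] using hble i)).2 (Finset.univ.filter fun i : Fin (n + n) => n ≤ (i : ℕ))
    simp only [zero_smul, Finset.sum_const_zero, zero_add, Fin.sum_univ_add, Fin.append_left,
      Fin.append_right, Finset.mem_filter, Finset.mem_univ, true_and, Fin.val_castAdd,
      Fin.val_natAdd, Nat.le_add_right, if_true, neg_smul, Finset.sum_neg_distrib,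
      ← sub_eq_add_neg, ← Finset.sum_smul] at h1
    have h2 : ∀ i : Fin n, ¬ n ≤ (i : ℕ) := fun i => not_le.2 i.isLt
    simp only [h2, if_false] at h1
    rw [Fin.sum_univ_eq_sum_range (fun i => b i) n, hb1, one_smul, ← hy] at h1
    have h3 : ‖∑ i : Fin n, b i • e (k + i) - ∑ i : Fin n, b i • e (k + (n + i))‖ ≤ ε + ε := by
      rw [← J.norm_map, map_sub]
      have h4 := hbk' (k + n)
      simp only [add_assoc] at h4
      refine le_trans (le_of_eq ?_) ((norm_sub_le _ _).trans (add_le_add (hbk' k) h4))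
      congr 1
      abel
    linarith
  have hmain : |‖∑ j, a j • x (s j) + r • y‖ -
      ‖∑ j, a j • e (j : ℕ) + r • ∑ i : Fin n, b i • e (k + i)‖| ≤ R * ε := by
    have hinv : R⁻¹ ≤ 1 := inv_le_one_of_one_le₀ (by rw [hR]; linarith [Nat.cast_nonneg (α := ℝ) K])
    have h1 := (ht (fun j => R⁻¹ * a j) (Fin.append (fun i => R⁻¹ * r * b i) fun _ => 0)
      (fun j => by
        rw [abs_mul, abs_of_pos (inv_pos.2 hRpos)]
        exact mul_le_one₀ hinv (abs_nonneg _) (ha j)) (fun i => by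
      refine Fin.addCases (fun i => ?_) (fun i => ?_) i
      · rw [Fin.append_left, abs_mul, abs_mul, abs_of_pos (inv_pos.2 hRpos)]
        refine mul_le_one₀ ?_ (abs_nonneg _) (hble i)
        rw [inv_mul_le_iff₀ hRpos, mul_one]
        linarith
      · rw [Fin.append_right, abs_zero]
        exact zero_le_one)).1
    simp only [Fin.sum_univ_add, Fin.append_left, Fin.append_right, Fin.val_castAdd, zero_smul,
      Finset.sum_const_zero, add_zero, mul_smul, ← Finset.smul_sum, ← smul_add, norm_smul,
      norm_inv, Real.norm_eq_abs, abs_of_pos hRpos, ← mul_sub, abs_mul, abs_inv] at h1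
    rw [inv_mul_le_iff₀ hRpos] at h1
    exact h1.trans (mul_le_mul_of_nonneg_left hm1.le hRpos.le)
  have hrR : |r| ≤ R := by linarith
  have h1 : |‖∑ j, a j • x (s j) + r • x₀‖ - ‖∑ j, a j • x (s j) + r • y‖| ≤ R * (3 * ε) := by
    refine (abs_norm_sub_norm_le _ _).trans ?_
    rw [add_sub_add_left_eq_sub, ← smul_sub, norm_smul, norm_sub_rev, Real.norm_eq_abs]
    exact mul_le_mul hrR hyx (norm_nonneg _) hRpos.le
  have h2 : |‖∑ j, a j • e (j : ℕ) + r • ∑ i : Fin n, b i • e (k + i)‖ -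
      ‖∑ j, a j • (e (j : ℕ) : UniformSpace.Completion E) + r • v‖| ≤ R * ε := by
    rw [← J.norm_map, map_add, map_sum, map_smul]
    simp only [map_smul, hJ (e _)]
    refine (abs_norm_sub_norm_le _ _).trans ?_
    rw [add_sub_add_left_eq_sub, ← smul_sub, norm_smul, Real.norm_eq_abs]
    exact mul_le_mul hrR (hbk' k) (norm_nonneg _) hRpos.le
  have h3 : R * (3 * ε) + R * ε + R * ε = η := by rw [hε]; field_simp; norm_num
  rw [abs_le] at h1 h2 hmain ⊢
  constructor <;> linarith [h1.1, h1.2, h2.1, h2.2, hmain.1, hmain.2]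

end Decomposition

theorem IsPlegma.elt_zero_le {k : ℕ} {s : Fin (k + 1) → Finset ℕ} (hs : IsPlegma s)
    (j : Fin (k + 1)) : elt (s 0) 0 ≤ elt (s j) 0 := by
  rcases eq_or_ne j 0 with rfl | hj
  · exact le_rfl
  · exact (hs.lt_same 0 j (Fin.pos_iff_ne_zero.2 hj) 0 (Finset.card_pos.2 (hs.nonempty 0))
      (Finset.card_pos.2 (hs.nonempty j))).le

section Consequences

variable {E : Type*} [SeminormedAddCommGroup E] [NormedSpace ℝ E]

theorem IsTrivialSeq.not_isSchauderBasic {e : ℕ → E} (h : IsTrivialSeq e) :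
    ¬ IsSchauderBasic e := by
  rintro ⟨hne, C, -, hC⟩
  have h1 := hC 1 2 one_le_two fun i => if i = 0 then 1 else -1
  simp only [Finset.sum_range_succ, Finset.range_zero, Finset.sum_empty, if_true, zero_add,
    one_ne_zero, if_false, one_smul, neg_smul, ← sub_eq_add_neg] at h1
  rw [h 0 1, mul_zero] at h1
  exact hne 0 (le_antisymm h1 (norm_nonneg _))

theorem IsSpreadingSeq.isTrivialSeq_or_isSchauderBasic {e : ℕ → E} (he : IsSpreadingSeq e)
    (h : ∃ C : ℝ, 1 ≤ C ∧ ∀ (m : ℕ) (A : Finset ℕ), A ⊆ Finset.range m → ∀ a : ℕ → ℝ,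
      ‖∑ n ∈ A, a n • e n‖ ≤ C * ‖∑ n ∈ Finset.range m, a n • e n‖) :
    IsTrivialSeq e ∨ IsSchauderBasic e := by
  obtain ⟨C, hC, hb⟩ := h
  by_cases h0 : ‖e 0‖ = 0
  · refine Or.inl fun n m => le_antisymm ((norm_sub_le _ _).trans ?_) (norm_nonneg _)
    rw [he.norm_eq n, he.norm_eq m, h0, add_zero]
  · exact Or.inr ⟨fun n => by rwa [he.norm_eq n], C, hC, fun k m hkm a =>
      hb m _ (Finset.range_subset_range.2 hkm) a⟩

end Consequences

end FSpread

theorem corollary6p15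
    {X : Type*} [NormedAddCommGroup X] [NormedSpace ℝ X] [CompleteSpace X]
    {E : Type*} [SeminormedAddCommGroup E] [NormedSpace ℝ E]
    (F : Set (Finset ℕ)) (hF : FSpread.IsRegularThin F)
    (hF₁ : ∃ s ∈ F, s.Nonempty)
    (x : Finset ℕ → X) (hx : FSpread.IsWRC F x)
    (e : ℕ → E) (he : FSpread.IsSpreadingSeq e) (hadm : FSpread.Admits F x e) :
    ((FSpread.IsTrivialSeq e ∧ ¬ FSpread.IsSingular e ∧ ¬ FSpread.IsSchauderBasic e) ∨
      (¬ FSpread.IsTrivialSeq e ∧ FSpread.IsSingular e ∧ ¬ FSpread.IsSchauderBasic e) ∨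
      (¬ FSpread.IsTrivialSeq e ∧ ¬ FSpread.IsSingular e ∧ FSpread.IsSchauderBasic e)) ∧
    (FSpread.IsSingular e →
      ∃ v : UniformSpace.Completion E, FSpread.IsNaturalPart e v ∧
        ∃ (L : ℕ → ℕ) (x₀ : X), StrictMono L ∧
          FSpread.Generates F (fun s => x s - x₀) L
            (fun n => (e n : UniformSpace.Completion E) - v) ∧
          ‖x₀‖ = ‖v‖) ∧
    (FSpread.IsSchauderBasic e → FSpread.IsUnconditional e) := by
  obtain ⟨M, hM, hgen⟩ := hadm
  obtain ⟨x₀, L, δ, hL, hδ, hU⟩ := FSpread.exists_extension_estimates hF hF₁ hx hM hgen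
  obtain ⟨hsup, hlow⟩ := FSpread.suppression_of_replacement (x := x) (x₀ := x₀) (e := e) hδ
    (fun m n hnm => by
      obtain ⟨t, ht⟩ := hU m n 0 (fun i => i.elim0) hnm (by omega) (fun i => i.elim0)
        (FSpread.isPlegma_of_fin_zero _) (fun i => i.elim0)
      refine ⟨t, fun b hb => ?_⟩
      simpa using ht (fun i => i.elim0) b (fun i => i.elim0) hb)
  have hdich := FSpread.exists_projection_bound_or_small_convex he (norm_nonneg x₀) hsup
  refine ⟨?_, fun hs => ?_, fun hb => ?_⟩
  · by_cases ht : FSpread.IsTrivialSeq e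
    · exact Or.inl ⟨ht, fun h => h.2.1 ht, ht.not_isSchauderBasic⟩
    · by_cases hb : FSpread.IsSchauderBasic e
      · exact Or.inr (Or.inr ⟨ht, fun h => h.2.2 hb, hb⟩)
      · exact Or.inr (Or.inl ⟨ht, ⟨he, ht, hb⟩, hb⟩)
  · rcases hdich with hproj | ⟨hpos, hsmall⟩
    · rcases he.isTrivialSeq_or_isSchauderBasic hproj with h | h
      · exact absurd h hs.2.1
      · exact absurd h hs.2.2
    obtain ⟨v, hv⟩ := FSpread.exists_isConvexLimit he hsup hsmall
    have hnorm : ‖x₀‖ = ‖v‖ := by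
      refine eq_of_forall_dist_le fun η hη => ?_
      obtain ⟨m, hm⟩ := (hv.eventually_norm_near hδ hU 1 hη).exists
      have := hm 0 (fun i => i.elim0) 1 (fun i => i.elim0) zero_le_one (fun i => i.elim0)
        (by simp) (fun i => i.elim0) (FSpread.isPlegma_of_fin_zero _) (fun i => i.elim0)
      simpa [Real.dist_eq] using this
    refine ⟨v, ⟨?_, hv.mem_topologicalClosure, FSpread.tendsto_toWeakSpace hv.tendsto_dual⟩, ?_⟩
    · rw [← norm_pos_iff, ← hnorm]
      exact hpos
    have hev : ∀ l : ℕ, ∀ᶠ m in atTop, ∀ k : ℕ, k ≤ l → ∀ a : Fin (k + 1) → ℝ,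
        (∀ j, a j ∈ Set.Icc (-1 : ℝ) 1) → ∀ s : Fin (k + 1) → Finset ℕ,
        (∀ j, s j ∈ FSpread.restrictFam F L) → FSpread.IsPlegma s →
        L m ≤ FSpread.elt (s 0) 0 →
          |‖∑ j, a j • (x (s j) - x₀)‖ -
            ‖∑ j, a j • ((e (j : ℕ) : UniformSpace.Completion E) - v)‖| ≤ 1 / ((l : ℝ) + 1) := by
      intro l
      filter_upwards [hv.eventually_norm_near hδ hU (l + 1)
        (η := 1 / ((l : ℝ) + 1)) Nat.one_div_pos_of_nat] with m hm k hk a ha s hsL hsp hsl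
      have hab : ∀ j, |a j| ≤ 1 := fun j => abs_le.2 (ha j)
      have h1 := hm (k + 1) a (-∑ j, a j) s (by omega) hab (by
        rw [abs_neg]
        refine (Finset.abs_sum_le_sum_abs _ _).trans ((Finset.sum_le_sum fun j _ => hab j).trans ?_)
        simp only [Finset.sum_const, Finset.card_univ, Fintype.card_fin, nsmul_eq_mul, mul_one]
        exact_mod_cast Nat.succ_le_succ hk) hsL hsp fun j => hsl.trans (hsp.elt_zero_le j)
      simpa only [smul_sub, Finset.sum_sub_distrib, ← Finset.sum_smul, neg_smul,
        ← sub_eq_add_neg] using h1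
    obtain ⟨φ, hφ, hφP⟩ := extraction_forall_of_eventually hev
    refine ⟨L ∘ φ, x₀, hL.comp hφ, ⟨hv.linearIndependent_sub he hs.2.1,
      fun l => 1 / ((l : ℝ) + 1), fun l => Nat.one_div_pos_of_nat,
      tendsto_one_div_add_atTop_nhds_zero_nat, fun l k hk a ha s hsL hsp hsl => ?_⟩, hnorm⟩
    exact hφP l k hk a ha s
      (fun j => ⟨(hsL j).1, (hsL j).2.trans (Set.range_comp_subset_range φ L)⟩) hsp hsl
  · rcases hdich with ⟨C, -, hC⟩ | ⟨hpos, hsmall⟩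
    · exact ⟨C, hC⟩
    · obtain ⟨v, hv⟩ := FSpread.exists_isConvexLimit he hsup hsmall
      exact absurd hb (hv.not_isSchauderBasic hpos hlow)
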